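/- **Theorem.** Let $G\subset\mathbb C$ be a bounded domain whose boundary is a rectifiable Jordan curve, let $\varphi$ be a conformal map of the unit disk $\mathbb D$ onto $G$, and let $\psi:G\to\mathbb D$ be its inverse. Let $\omega$ be a positive measurable function on $(0,1]$ with $$\iint_G \omega(1-|\psi(z)|)\,dm_2(z)<\infty ,$$ where $m_2$ is Lebesgue area measure. Let $B_2(G,\omega)$ be the space of analytic functions $g$ on $G$ with $$\|g\|_{B_2}=\Bigl(\iint_G |g(z)|^2\,\omega(1-|\psi(z)|)\,dm_2(z)\Bigr)^{1/2}<\infty ,$$ and assume that the polynomials are dense in $B_2(G,\omega)$. For $g\in B_2(G,\omega)$ let $$(Kg)(\zeta)=\frac1\pi\iint_G\frac{\overline{g(z)}\,\omega(1-|\psi(z)|)}{z-\zeta}\,dm_2(z),\qquad \zeta\in\mathbb C\setminus\overline G .$$ Put $\omega_k=2\int_0^1 r^{2k+1}\omega(1-r)\,dr$ for $k\ge 0$, and for $f\in L^1(0,2\pi)$ with Fourier series $f(e^{i\theta})\sim\sum_{k\in\mathbb Z}f_ke^{ik\theta}$ put $$\rho(f)=\Bigl(\pi\sum_{k=1}^\infty\frac{|f_{-k}|^2}{\omega_{k-1}}\Bigr)^{1/2}\in[0,\infty].$$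 Let $\overline W_\omega(0,2\pi)$ be the set of functions $\gamma$ analytic in $\mathbb C\setminus\overline G$ with $\gamma(\zeta)\to0$ as $\zeta\to\infty$ for which there are domains $G_n$ $(n\in\mathbb N)$ with $\overline{G_n}\subset G_{n+1}\subset G$ and $\bigcup_nG_n=G$, and functions $\gamma_n$, such that 1. $\gamma_n$ is analytic in $\mathbb C\setminus\overline{G_n}$ and $\gamma_n(\zeta)\to0$ as $\zeta\to\infty$; 2. $\gamma_n\to\gamma$ uniformly on every compact subset of $\mathbb C\setminus\overline G$; 3. $\gamma_n\circ\varphi\in L^1(0,2\pi)$ for every $n$ and $\sup_n\rho(\gamma_n\circ\varphi)<\infty$, where $\gamma_n\circ\varphi$ is the function $\theta\mapsto\gamma_n(\varphi(e^{i\theta}))$ and $\varphi(e^{i\theta})=\lim_{r\to1^-}\varphi(re^{i\theta})$. Then, as sets of functions on $\mathbb C\setminus\overline G$, $$K\bigl(B_2(G,\omega)\bigr)=\overline W_\omega(0,2\pi).$$ -/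

import Mathlib

open Set Filter Topology MeasureTheory

noncomputable section

namespace CauchyBergman

/-- `J` is a rectifiable Jordan curve: the image of a closed curve of finite length that is simple
(injective on the half-open parameter interval). -/
def IsRectifiableJordanCurve (J : Set ℂ) : Prop :=
  ∃ c : ℝ → ℂ, ContinuousOn c (Icc 0 1) ∧ c 0 = c 1 ∧ InjOn c (Ico 0 1) ∧
    BoundedVariationOn c (Icc 0 1) ∧ c '' Icc 0 1 = J

/-- `φ` maps the open unit disk conformally onto `G`. -/
def IsConformalOfDisk (φ : ℂ → ℂ) (G : Set ℂ) : Prop :=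
  DifferentiableOn ℂ φ (Metric.ball 0 1) ∧ BijOn φ (Metric.ball 0 1) G

/-- The norm `‖g‖ = (∬_G |g(z)|² ω(1 - |ψ(z)|) dm₂(z))^{1/2}`, with values in `[0, ∞]`. -/
def bergmanNorm (G : Set ℂ) (ω : ℝ → ℝ) (ψ : ℂ → ℂ) (g : ℂ → ℂ) : ENNReal :=
  (∫⁻ z in G, ENNReal.ofReal (‖g z‖ ^ 2 * ω (1 - ‖ψ z‖))) ^ (1 / 2 : ℝ)

/-- The weighted Bergman space `B₂(G, ω)`. Only the values on `G` of its elements matter. -/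
def bergmanSpace (G : Set ℂ) (ω : ℝ → ℝ) (ψ : ℂ → ℂ) : Set (ℂ → ℂ) :=
  {g | DifferentiableOn ℂ g G ∧ bergmanNorm G ω ψ g < ⊤}

/-- Polynomials are dense in `B₂(G, ω)`. -/
def PolynomialsDense (G : Set ℂ) (ω : ℝ → ℝ) (ψ : ℂ → ℂ) : Prop :=
  ∀ g ∈ bergmanSpace G ω ψ, ∀ ε : ENNReal, 0 < ε →
    ∃ p : Polynomial ℂ, bergmanNorm G ω ψ (fun z => g z - p.eval z) < ε

/-- The weighted Cauchy transform
`(Kg)(ζ) = π⁻¹ ∬_G conj(g(z)) ω(1 - |ψ(z)|) / (z - ζ) dm₂(z)`, meant for `ζ ∉ closure G`. -/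
def cauchyTransform (G : Set ℂ) (ω : ℝ → ℝ) (ψ : ℂ → ℂ) (g : ℂ → ℂ) (ζ : ℂ) : ℂ :=
  (1 / (Real.pi : ℂ)) *
    ∫ z in G, (starRingEnd ℂ) (g z) * ((ω (1 - ‖ψ z‖) : ℝ) : ℂ) / (z - ζ)

/-- The moments `ω_k = 2 ∫₀¹ r^{2k+1} ω(1 - r) dr`. -/
def moment (ω : ℝ → ℝ) (k : ℕ) : ℝ :=
  2 * ∫ r in (0 : ℝ)..1, r ^ (2 * k + 1) * ω (1 - r)

/-- `ρ(f) = (π ∑_{k ≥ 1} |f_{-k}|² / ω_{k-1})^{1/2}`, with values in `[0, ∞]`, where `f` is given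
as a function of the angle `θ ∈ (0, 2π)` and `f_k` are its Fourier coefficients. -/
def rho (ω : ℝ → ℝ) (f : ℝ → ℂ) : ENNReal :=
  (ENNReal.ofReal Real.pi *
    ∑' k : ℕ, ENNReal.ofReal
      (‖fourierCoeffOn Real.two_pi_pos f (-((k : ℤ) + 1))‖ ^ 2 / moment ω k)) ^ (1 / 2 : ℝ)

/-- The space `W_ω(0, 2π)`. -/
def spaceW (ω : ℝ → ℝ) : Set (ℝ → ℂ) :=
  {f | IntervalIntegrable f volume 0 (2 * Real.pi) ∧ rho ω f < ⊤}

/-- The boundary function `θ ↦ φ(e^{iθ})` of a map `φ` of the open unit disk, given by radial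
limits. -/
def boundaryValue (φ : ℂ → ℂ) (θ : ℝ) : ℂ :=
  limUnder (𝓝[<] (1 : ℝ)) (fun r => φ (circleMap 0 r θ))

/-- A sequence of domains approximating `G` from the inside. -/
structure ApproximatesFromInside (Gs : ℕ → Set ℂ) (G : Set ℂ) : Prop where
  isOpen : ∀ n, IsOpen (Gs n)
  isConnected : ∀ n, IsConnected (Gs n)
  closure_subset : ∀ n, closure (Gs n) ⊆ Gs (n + 1)
  subset : ∀ n, Gs n ⊆ G
  iUnion_eq : ⋃ n, Gs n = G

/-- `γ` is analytic in the complement of `closure D` in the Riemann sphere, with `γ(∞) = 0`;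
here `D` is a bounded set. -/
def AnalyticOutside (D : Set ℂ) (γ : ℂ → ℂ) : Prop :=
  DifferentiableOn ℂ γ (closure D)ᶜ ∧ Tendsto γ (Bornology.cobounded ℂ) (𝓝 0)

/-- The space `W̄_ω(0, 2π)`. Only the values outside `closure G` of its elements matter. -/
def spaceWBar (G : Set ℂ) (ω : ℝ → ℝ) (φ : ℂ → ℂ) : Set (ℂ → ℂ) :=
  {γ | AnalyticOutside G γ ∧
    ∃ (Gs : ℕ → Set ℂ) (γs : ℕ → ℂ → ℂ),
      ApproximatesFromInside Gs G ∧
      (∀ n, AnalyticOutside (Gs n) (γs n)) ∧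
      (∀ L : Set ℂ, IsCompact L → L ⊆ (closure G)ᶜ → TendstoUniformlyOn γs γ atTop L) ∧
      (∀ n, (fun θ => γs n (boundaryValue φ θ)) ∈ spaceW ω) ∧
      ⨆ n, rho ω (fun θ => γs n (boundaryValue φ θ)) < ⊤}

end CauchyBergman

end

/-!
The proof transfers everything to the unit disk, where the Bergman space becomes a space of power
series with explicit orthogonal basis.

Write `h = (g ∘ φ) φ'` and let `μ` be the measure `ω(1 - |w|) dm₂(w)` on the disk. The map `g ↦ h`
is an isometry onto the analytic functions in `L²(μ)`, and
`(Kg)(ζ) = π⁻¹ ∫ conj h · φ' / (φ - ζ) dμ`. By rotation invariance of `μ` the monomials `w ^ k` are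
orthogonal in `L²(μ)` with `‖w ^ k‖² = π ω_k`, and integrating an analytic function against
`conj w ^ k` gives `π ω_k` times its Taylor coefficient (`IsDiskWeight.integral_mul_conj_pow`).

The boundary values of `φ` need only the finiteness of the area `∬ |φ'|²` of `G`: almost every
radius has an image of finite length, so radial limits exist almost everywhere, and they lie on the
boundary of `G` (`ae_tendsto_boundaryValue`). If `γ` is analytic off a compact subset of `G`, then
`γ ∘ φ` has a Laurent expansion near the unit circle, so the Fourier coefficients of the boundary
function can be computed on a circle of radius `r < 1` (`fourierCoeffOn_comp_boundaryValue`).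

*Cauchy transforms lie in the closure space.* Restricting the integral to the disk of radius
`r_n ↑ 1` gives functions `γ_n`, analytic off the closure of `φ(r_n 𝔻)`. By Fubini and the residue
theorem the coefficient of index `-(k + 1)` of `γ_n ∘ φ` is `-π⁻¹` times the conjugate of
`∫_{r_n 𝔻} h · conj w ^ k dμ` (`fourierCoeffOn_diskCauchy`), so Bessel's inequality bounds
`ρ(γ_n ∘ φ)` by the norm of `g`.

*Members of the closure space are Cauchy transforms.* Let `γ_n → γ` as in the definition, and let
`x_{n,k}` be the coefficient of index `-(k + 1)` of `γ_n ∘ φ`. Cauchy's formula in the exterior of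
the curves `φ(|w| = r)`, obtained from Liouville's theorem (`exterior_cauchy_formula`), gives
`γ_n(ζ) = -∑ b_k x_{n,k}`, where `b_k` are the Taylor coefficients of `φ' / (φ - ζ)`. The bound on
`ρ` makes the sequences `x_{n,k} / √ω_k` bounded in `ℓ²`; a weak limit of them is the coefficient
sequence of an analytic function `h` in `L²(μ)` (`exists_analytic_of_lp`), and passing to the limit
in the formula shows that `γ` is the Cauchy transform of `g = (h ∘ ψ) ψ'`.
-/

namespace CauchyBergman

open Metric Complex ComplexConjugate
open scoped ENNReal

/-! ### Conformal maps of the disk -/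

theorem inv_sub_eq_inv_mul_inv_dslope (φ : ℂ → ℂ) (w₀ w : ℂ) :
    (φ w - φ w₀)⁻¹ = (w - w₀)⁻¹ * (dslope φ w₀ w)⁻¹ := by
  rw [← mul_inv, ← sub_smul_dslope, smul_eq_mul]

/-- `φ` maps the unit disk conformally onto the bounded open set `G`, and `ψ` inverts it. -/
structure IsConformalPair (φ ψ : ℂ → ℂ) (G : Set ℂ) : Prop where
  isOpen : IsOpen G
  isBounded : Bornology.IsBounded G
  differentiableOn : DifferentiableOn ℂ φ (ball 0 1)
  bijOn : BijOn φ (ball 0 1) G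
  invOn : InvOn ψ φ (ball 0 1) G

namespace IsConformalPair

variable {φ ψ : ℂ → ℂ} {G : Set ℂ}

theorem mapsTo (h : IsConformalPair φ ψ G) : MapsTo φ (ball 0 1) G := h.bijOn.mapsTo

theorem injOn (h : IsConformalPair φ ψ G) : InjOn φ (ball 0 1) := h.bijOn.injOn

theorem mapsTo_symm (h : IsConformalPair φ ψ G) : MapsTo ψ G (ball 0 1) := by
  intro z hz
  obtain ⟨w, hw, rfl⟩ := h.bijOn.surjOn hz
  rwa [h.invOn.1 hw]

theorem symm_apply (h : IsConformalPair φ ψ G) {w : ℂ} (hw : w ∈ ball (0 : ℂ) 1) :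
    ψ (φ w) = w := h.invOn.1 hw

theorem apply_symm (h : IsConformalPair φ ψ G) {z : ℂ} (hz : z ∈ G) : φ (ψ z) = z := h.invOn.2 hz

theorem analyticOnNhd (h : IsConformalPair φ ψ G) : AnalyticOnNhd ℂ φ (ball 0 1) :=
  h.differentiableOn.analyticOnNhd isOpen_ball

theorem differentiableAt (h : IsConformalPair φ ψ G) {w : ℂ} (hw : w ∈ ball (0 : ℂ) 1) :
    DifferentiableAt ℂ φ w := h.differentiableOn.differentiableAt (isOpen_ball.mem_nhds hw)

theorem differentiableOn_deriv (h : IsConformalPair φ ψ G) :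
    DifferentiableOn ℂ (deriv φ) (ball 0 1) := h.differentiableOn.deriv isOpen_ball

theorem isOpen_image (h : IsConformalPair φ ψ G) {s : Set ℂ} (hs : s ⊆ ball 0 1)
    (hso : IsOpen s) : IsOpen (φ '' s) := by
  rcases h.analyticOnNhd.is_constant_or_isOpen (convex_ball 0 1).isPreconnected with ⟨c, hc⟩ | H
  · have h0 : (0 : ℂ) ∈ ball (0 : ℂ) 1 := by simp
    have h1 : (1 / 2 : ℂ) ∈ ball (0 : ℂ) 1 := by
      simp only [mem_ball_zero_iff]; norm_num
    have := h.injOn h0 h1 ((hc _ h0).trans (hc _ h1).symm)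
    norm_num at this
  · exact H s hs hso

theorem continuousOn_symm (h : IsConformalPair φ ψ G) : ContinuousOn ψ G := by
  rw [continuousOn_open_iff h.isOpen]
  intro t ht
  have : G ∩ ψ ⁻¹' t = φ '' (ball 0 1 ∩ t) := by
    ext z
    constructor
    · rintro ⟨hz, hzt⟩
      exact ⟨ψ z, ⟨h.mapsTo_symm hz, hzt⟩, h.apply_symm hz⟩
    · rintro ⟨w, ⟨hw, hwt⟩, rfl⟩
      exact ⟨h.mapsTo hw, by rwa [mem_preimage, h.symm_apply hw]⟩
  rw [this]
  exact h.isOpen_image inter_subset_left (isOpen_ball.inter ht)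

theorem differentiableAt_symm_of_deriv_ne_zero (h : IsConformalPair φ ψ G) {w : ℂ}
    (hw : w ∈ ball (0 : ℂ) 1) (hd : deriv φ w ≠ 0) : DifferentiableAt ℂ ψ (φ w) := by
  have hG : G ∈ 𝓝 (φ w) := h.isOpen.mem_nhds (h.mapsTo hw)
  have hc : ContinuousAt ψ (φ w) := h.continuousOn_symm.continuousAt hG
  refine (HasDerivAt.of_local_left_inverse hc (f := φ) (f' := deriv φ w) ?_ hd ?_).differentiableAt
  · rw [h.symm_apply hw]
    exact (h.differentiableAt hw).hasDerivAt
  · filter_upwards [hG] with z hz using h.apply_symm hz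

/-- The zeros of `φ'` are isolated, so `ψ` is analytic off a discrete set; being continuous it has
removable singularities there. -/
theorem differentiableOn_symm (h : IsConformalPair φ ψ G) : DifferentiableOn ℂ ψ G := by
  intro z hz
  refine DifferentiableAt.differentiableWithinAt ?_
  have hw : ψ z ∈ ball (0 : ℂ) 1 := h.mapsTo_symm hz
  have hA : AnalyticAt ℂ (deriv φ) (ψ z) := (h.analyticOnNhd _ hw).deriv
  rcases hA.eventually_eq_zero_or_eventually_ne_zero with h0 | h0
  · exfalso
    have hA' : AnalyticOnNhd ℂ (deriv φ) (ball 0 1) :=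
      h.differentiableOn_deriv.analyticOnNhd isOpen_ball
    have hall := hA'.eqOn_zero_of_preconnected_of_eventuallyEq_zero
      (convex_ball 0 1).isPreconnected hw h0
    have h00 : (0 : ℂ) ∈ ball (0 : ℂ) 1 := by simp
    have h1 : (1 / 2 : ℂ) ∈ ball (0 : ℂ) 1 := by
      simp only [mem_ball_zero_iff]; norm_num
    have := h.injOn h00 h1 (isOpen_ball.is_const_of_deriv_eq_zero
      (convex_ball 0 1).isPreconnected h.differentiableOn hall h00 h1)
    norm_num at this
  · refine (analyticAt_of_differentiable_on_punctured_nhds_of_continuousAt ?_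
      (h.continuousOn_symm.continuousAt (h.isOpen.mem_nhds hz))).differentiableAt
    have hc : Tendsto ψ (𝓝[≠] z) (𝓝[≠] (ψ z)) := by
      refine tendsto_nhdsWithin_iff.2 ⟨(h.continuousOn_symm.continuousAt
        (h.isOpen.mem_nhds hz)).tendsto.mono_left nhdsWithin_le_nhds, ?_⟩
      filter_upwards [self_mem_nhdsWithin, mem_nhdsWithin_of_mem_nhds (h.isOpen.mem_nhds hz)]
        with x hx hxG hxz
      exact hx (by rw [mem_singleton_iff, ← h.apply_symm hxG, hxz, h.apply_symm hz])
    filter_upwards [hc.eventually h0, mem_nhdsWithin_of_mem_nhds (h.isOpen.mem_nhds hz)]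
      with x hx hxG
    have := h.differentiableAt_symm_of_deriv_ne_zero (h.mapsTo_symm hxG) hx
    rwa [h.apply_symm hxG] at this

theorem deriv_symm_mul_deriv (h : IsConformalPair φ ψ G) {w : ℂ} (hw : w ∈ ball (0 : ℂ) 1) :
    deriv ψ (φ w) * deriv φ w = 1 := by
  have h1 : HasDerivAt ψ (deriv ψ (φ w)) (φ w) :=
    (h.differentiableOn_symm.differentiableAt (h.isOpen.mem_nhds (h.mapsTo hw))).hasDerivAt
  have h2 := h1.comp w (h.differentiableAt hw).hasDerivAt
  refine h2.unique ((hasDerivAt_id w).congr_of_eventuallyEq ?_)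
  filter_upwards [isOpen_ball.mem_nhds hw] with x hx using h.symm_apply hx

theorem deriv_ne_zero (h : IsConformalPair φ ψ G) {w : ℂ} (hw : w ∈ ball (0 : ℂ) 1) :
    deriv φ w ≠ 0 := right_ne_zero_of_mul_eq_one (h.deriv_symm_mul_deriv hw)

/-- The divided difference `(φ(w) - φ(w₀)) / (w - w₀)` of a univalent function has no zeros. -/
theorem dslope_ne_zero (h : IsConformalPair φ ψ G) {w₀ w : ℂ} (hw₀ : w₀ ∈ ball (0 : ℂ) 1)
    (hw : w ∈ ball (0 : ℂ) 1) : dslope φ w₀ w ≠ 0 := by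
  rcases eq_or_ne w w₀ with rfl | hne
  · rw [dslope_same]; exact h.deriv_ne_zero hw
  · rw [dslope_of_ne _ hne, slope_def_field]
    exact div_ne_zero (sub_ne_zero.2 fun e => hne (h.injOn hw hw₀ e)) (sub_ne_zero.2 hne)

theorem differentiableOn_dslope (h : IsConformalPair φ ψ G) {w₀ : ℂ}
    (hw₀ : w₀ ∈ ball (0 : ℂ) 1) : DifferentiableOn ℂ (dslope φ w₀) (ball 0 1) :=
  (Complex.differentiableOn_dslope (isOpen_ball.mem_nhds hw₀)).2 h.differentiableOn

theorem hasFDerivWithinAt (h : IsConformalPair φ ψ G) {S : Set ℂ} (hS : S ⊆ ball 0 1) {w : ℂ}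
    (hw : w ∈ S) : HasFDerivWithinAt φ
      ((ContinuousLinearMap.toSpanSingleton ℂ (deriv φ w)).restrictScalars ℝ) S w :=
  ((h.differentiableAt (hS hw)).hasDerivAt.hasFDerivAt.restrictScalars ℝ).hasFDerivWithinAt

end IsConformalPair

theorem abs_det_toSpanSingleton_restrictScalars (a : ℂ) :
    |((ContinuousLinearMap.toSpanSingleton ℂ a).restrictScalars ℝ).det| = ‖a‖ ^ 2 := by
  have : ((ContinuousLinearMap.toSpanSingleton ℂ a).restrictScalars ℝ).det = ‖a‖ ^ 2 := by
    rw [ContinuousLinearMap.det, ContinuousLinearMap.coe_restrictScalars,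
      LinearMap.det_restrictScalars, Algebra.norm_complex_apply, Complex.normSq_eq_norm_sq]
    congr 2
    rw [LinearMap.det_ring]
    simp
  rw [this, abs_of_nonneg (by positivity)]

namespace IsConformalPair

variable {φ ψ : ℂ → ℂ} {G : Set ℂ}

theorem lintegral_image (h : IsConformalPair φ ψ G) {S : Set ℂ} (hS : S ⊆ ball 0 1)
    (hSm : MeasurableSet S) (f : ℂ → ENNReal) :
    ∫⁻ z in φ '' S, f z = ∫⁻ w in S, ENNReal.ofReal (‖deriv φ w‖ ^ 2) * f (φ w) := by
  rw [lintegral_image_eq_lintegral_abs_det_fderiv_mul volume hSm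
    (fun w hw => h.hasFDerivWithinAt hS hw) (h.injOn.mono hS)]
  simp_rw [abs_det_toSpanSingleton_restrictScalars]

theorem integral_image (h : IsConformalPair φ ψ G) {S : Set ℂ} (hS : S ⊆ ball 0 1)
    (hSm : MeasurableSet S) (f : ℂ → ℂ) :
    ∫ z in φ '' S, f z = ∫ w in S, (‖deriv φ w‖ ^ 2) • f (φ w) := by
  rw [integral_image_eq_integral_abs_det_fderiv_smul volume hSm
    (fun w hw => h.hasFDerivWithinAt hS hw) (h.injOn.mono hS)]
  simp_rw [abs_det_toSpanSingleton_restrictScalars]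

theorem integrableOn_image {E : Type*} [NormedAddCommGroup E] [NormedSpace ℝ E]
    (h : IsConformalPair φ ψ G) {S : Set ℂ} (hS : S ⊆ ball 0 1)
    (hSm : MeasurableSet S) (f : ℂ → E) :
    IntegrableOn f (φ '' S) ↔ IntegrableOn (fun w => (‖deriv φ w‖ ^ 2) • f (φ w)) S := by
  rw [integrableOn_image_iff_integrableOn_abs_det_fderiv_smul volume hSm
    (fun w hw => h.hasFDerivWithinAt hS hw) (h.injOn.mono hS)]
  simp_rw [abs_det_toSpanSingleton_restrictScalars]

end IsConformalPair

/-! ### Polar coordinates and radial limits -/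

/-- The measure `r dr` on `(0, 1)`. -/
noncomputable def radialMeasure : Measure ℝ :=
  (volume.restrict (Ioo 0 1)).withDensity (fun r => ENNReal.ofReal r)

instance : SFinite radialMeasure := by unfold radialMeasure; infer_instance

/-- The measure `dθ` on `(0, 2π]`. -/
noncomputable def angleMeasure : Measure ℝ := volume.restrict (Ioc 0 (2 * Real.pi))

instance : IsFiniteMeasure angleMeasure := by unfold angleMeasure; infer_instance

theorem lintegral_radialMeasure (f : ℝ → ENNReal) :
    ∫⁻ r, f r ∂radialMeasure = ∫⁻ r in Ioo 0 1, ENNReal.ofReal r * f r := by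
  rw [radialMeasure, lintegral_withDensity_eq_lintegral_mul_non_measurable]
  · rfl
  · fun_prop
  · simp

theorem measurable_circleMap_uncurry : Measurable (fun p : ℝ × ℝ => circleMap 0 p.1 p.2) := by
  unfold circleMap; fun_prop

theorem lintegral_angleMeasure_circleMap (f : ℂ → ENNReal) (r : ℝ) :
    ∫⁻ θ, f (circleMap 0 r θ) ∂angleMeasure =
      ∫⁻ θ in Ioo (-Real.pi) Real.pi, f (circleMap 0 r θ) := by
  rw [restrict_Ioo_eq_restrict_Ioc, angleMeasure]
  have h1 := isAddFundamentalDomain_Ioc Real.two_pi_pos 0 volume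
  have h2 := isAddFundamentalDomain_Ioc Real.two_pi_pos (-Real.pi) volume
  have := h1.setLIntegral_eq h2 (fun θ => f (circleMap 0 r θ)) (by
    rintro ⟨g, hg⟩ x
    obtain ⟨n, rfl⟩ := AddSubgroup.mem_zmultiples_iff.1 hg
    have := (periodic_circleMap 0 r).int_mul n x
    simp only [AddSubgroup.vadd_def, vadd_eq_add, zsmul_eq_mul]
    rw [add_comm, this])
  rw [zero_add, show -Real.pi + 2 * Real.pi = Real.pi by ring] at this
  exact this

/-- Polar coordinates on the unit disk, as a measure preserving map. -/
theorem measurePreserving_circleMap :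
    MeasurePreserving (fun p : ℝ × ℝ => circleMap 0 p.1 p.2) (radialMeasure.prod angleMeasure)
      (volume.restrict (ball (0 : ℂ) 1)) := by
  refine ⟨measurable_circleMap_uncurry, ?_⟩
  ext s hs
  have hI : Measurable (indicator s (1 : ℂ → ENNReal)) := measurable_one.indicator hs
  rw [Measure.map_apply measurable_circleMap_uncurry hs,
    Measure.prod_apply (measurable_circleMap_uncurry hs), lintegral_radialMeasure]
  have e1 : ∀ r : ℝ, angleMeasure (Prod.mk r ⁻¹' ((fun p : ℝ × ℝ => circleMap 0 p.1 p.2) ⁻¹' s)) =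
      ∫⁻ θ in Ioo (-Real.pi) Real.pi, indicator s 1 (circleMap 0 r θ) := by
    intro r
    rw [← lintegral_angleMeasure_circleMap]
    have : MeasurableSet ((circleMap 0 r) ⁻¹' s) := measurable_circleMap 0 r hs
    rw [← lintegral_indicator_one (by exact this)]
    rfl
  simp_rw [e1]
  have e2 : volume.restrict (ball (0 : ℂ) 1) s =
      ∫⁻ z, indicator (ball 0 1 ∩ s) 1 z := by
    rw [lintegral_indicator_one (measurableSet_ball.inter hs), Measure.restrict_apply hs,
      inter_comm]
  rw [e2, ← Complex.lintegral_comp_polarCoord_symm, polarCoord_target, Measure.volume_eq_prod,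
    ← Measure.prod_restrict, lintegral_prod, ← lintegral_indicator measurableSet_Ioo,
    ← lintegral_indicator measurableSet_Ioi]
  · congr 1 with r
    by_cases h0 : 0 < r
    · have key : ∀ θ, (Complex.polarCoord.symm (r, θ)) = circleMap 0 r θ := by
        intro θ
        rw [Complex.polarCoord_symm_apply, circleMap_zero, Complex.exp_mul_I]
        simp
      have hnorm : ∀ θ, ‖circleMap 0 r θ‖ = r := fun θ => by simp [abs_of_pos h0]
      rw [indicator_of_mem (mem_Ioi.2 h0)]
      simp_rw [key]
      by_cases h1 : r < 1
      · rw [indicator_of_mem (by exact ⟨h0, h1⟩ : r ∈ Ioo (0 : ℝ) 1)]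
        simp only [smul_eq_mul]
        rw [← lintegral_const_mul _ (show Measurable fun θ => indicator s 1 (circleMap 0 r θ) from
          hI.comp (measurable_circleMap 0 r))]
        refine lintegral_congr fun θ => ?_
        by_cases hm : circleMap 0 r θ ∈ s
        · rw [indicator_of_mem hm, indicator_of_mem]
          exact ⟨by rw [mem_ball_zero_iff, hnorm]; exact h1, hm⟩
        · rw [indicator_of_notMem hm, indicator_of_notMem (fun h => hm h.2)]
      · rw [indicator_of_notMem (fun h => h1 h.2)]
        refine Eq.symm ((lintegral_congr fun θ => ?_).trans lintegral_zero)
        simp only [smul_eq_mul, mul_eq_zero]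
        right
        refine indicator_of_notMem (fun h => h1 ?_) _
        have := h.1
        rwa [mem_ball_zero_iff, hnorm] at this
    · rw [indicator_of_notMem (fun h => h0 h.1), indicator_of_notMem (fun h => h0 (mem_Ioi.1 h))]
  · have hp : Measurable (fun p : ℝ × ℝ => (Complex.polarCoord.symm p : ℂ)) := by
      simp_rw [Complex.polarCoord_symm_apply]
      fun_prop
    exact ((ENNReal.measurable_ofReal.comp measurable_fst).mul
      ((measurable_one.indicator (measurableSet_ball.inter hs)).comp hp)).aemeasurable

/-- A function on `(1/2, 1)` with integrable derivative has a limit at `1`. -/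
theorem exists_tendsto_of_integrableOn_deriv {u u' : ℝ → ℂ}
    (hu : ∀ r ∈ Ico (1 / 2 : ℝ) 1, HasDerivAt u (u' r) r)
    (hi : IntegrableOn u' (Icc (1 / 2) 1)) : ∃ p, Tendsto u (𝓝[<] 1) (𝓝 p) := by
  have hc := intervalIntegral.continuousOn_primitive_interval (f := u') (a := 1 / 2) (b := 1)
    (by rwa [uIcc_of_le (by norm_num)])
  have h1 : Tendsto (fun r => ∫ t in (1 / 2 : ℝ)..r, u' t) (𝓝[<] 1)
      (𝓝 (∫ t in (1 / 2 : ℝ)..1, u' t)) := by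
    refine (hc 1 (by simp)).mono_left ?_
    rw [uIcc_of_le (by norm_num), nhdsWithin_Icc_eq_nhdsLE (by norm_num)]
    exact nhdsWithin_mono _ Iio_subset_Iic_self
  refine ⟨u (1 / 2) + ∫ t in (1 / 2 : ℝ)..1, u' t, (tendsto_const_nhds.add h1).congr' ?_⟩
  filter_upwards [Ioo_mem_nhdsLT (by norm_num : (1 / 2 : ℝ) < 1)] with r hr
  rw [intervalIntegral.integral_eq_sub_of_hasDerivAt (f := u)]
  · ring
  · intro x hx
    rw [uIcc_of_le hr.1.le] at hx
    exact hu x ⟨hx.1, hx.2.trans_lt hr.2⟩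
  · rw [intervalIntegrable_iff_integrableOn_Icc_of_le hr.1.le]
    exact hi.mono_set (Icc_subset_Icc_right hr.2.le)

namespace IsConformalPair

variable {φ ψ : ℂ → ℂ} {G : Set ℂ}

theorem circleMap_mem_ball {r : ℝ} (hr : r ∈ Ioo (0 : ℝ) 1) (θ : ℝ) :
    circleMap 0 r θ ∈ ball (0 : ℂ) 1 := by
  rw [mem_ball_zero_iff, norm_circleMap_zero, abs_of_pos hr.1]; exact hr.2

theorem image_ball (h : IsConformalPair φ ψ G) : φ '' ball 0 1 = G := h.bijOn.image_eq

/-- Almost every radius has an image of finite length, because the area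
`∬ |φ'(re^{iθ})|² r dr dθ` of `G` is finite. -/
theorem ae_exists_radial_limit (h : IsConformalPair φ ψ G) :
    ∀ᵐ θ ∂angleMeasure, ∃ p, Tendsto (fun r => φ (circleMap 0 r θ)) (𝓝[<] 1) (𝓝 p) := by
  have hm : Measurable (deriv φ) := measurable_deriv φ
  have hmp : Measurable
      (fun p : ℝ × ℝ => ENNReal.ofReal (‖deriv φ (circleMap 0 p.1 p.2)‖ ^ 2)) :=
    ((hm.comp measurable_circleMap_uncurry).norm.pow_const 2).ennreal_ofReal
  have hfin : ∫⁻ w in ball 0 1, ENNReal.ofReal (‖deriv φ w‖ ^ 2) < ⊤ := by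
    have := h.lintegral_image (subset_refl _) measurableSet_ball (fun _ => 1)
    simp only [mul_one] at this
    rw [← this, h.image_ball, setLIntegral_one]
    exact h.isBounded.measure_lt_top
  rw [← measurePreserving_circleMap.lintegral_comp (by fun_prop), lintegral_prod_symm'] at hfin
  swap
  · exact hmp
  have hae := ae_lt_top hmp.lintegral_prod_left' hfin.ne
  filter_upwards [hae] with θ hθ
  rw [lintegral_radialMeasure] at hθ
  refine exists_tendsto_of_integrableOn_deriv
    (u' := fun r => deriv φ (circleMap 0 r θ) * exp (θ * I)) ?_ ?_
  · intro r hr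
    have h1 : HasDerivAt (fun r : ℝ => circleMap 0 r θ) (exp (θ * I)) r := by
      simp only [circleMap, zero_add]
      simpa using (HasDerivAt.ofReal_comp (hasDerivAt_id r)).mul_const (exp (θ * I))
    exact (h.differentiableAt (circleMap_mem_ball
      ⟨lt_of_lt_of_le (by norm_num) hr.1, hr.2⟩ θ)).hasDerivAt.comp r h1
  · rw [integrableOn_Icc_iff_integrableOn_Ioo]
    have hmr : Measurable (fun r : ℝ => circleMap 0 r θ) := by unfold circleMap; fun_prop
    refine ⟨(Measurable.mul (hm.comp hmr) measurable_const).aestronglyMeasurable, ?_⟩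
    -- `|φ'| ≤ 1 + |φ'|² ≤ 1 + 2 r |φ'|²` for `r > 1/2`
    have hb : ∫⁻ r in Ioo (1 / 2 : ℝ) 1, (1 + 2 * (ENNReal.ofReal r *
        ENNReal.ofReal (‖deriv φ (circleMap 0 r θ)‖ ^ 2))) < ⊤ := by
      rw [lintegral_add_left measurable_const, lintegral_const_mul _ (by fun_prop)]
      refine ENNReal.add_lt_top.2 ⟨by simp, ENNReal.mul_lt_top (by simp) (lt_of_le_of_lt ?_ hθ)⟩
      exact lintegral_mono_set (Ioo_subset_Ioo_left (by norm_num))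
    refine lt_of_le_of_lt (setLIntegral_mono' measurableSet_Ioo fun r hr => ?_) hb
    have hr0 : (0 : ℝ) < r := lt_trans (by norm_num) hr.1
    rw [← ofReal_norm, norm_mul, Complex.norm_exp_ofReal_mul_I, mul_one,
      ← ENNReal.ofReal_mul hr0.le, ← ENNReal.ofReal_one,
      show (2 : ENNReal) = ENNReal.ofReal 2 by simp, ← ENNReal.ofReal_mul (by norm_num),
      ← ENNReal.ofReal_add (by norm_num) (by positivity)]
    refine ENNReal.ofReal_le_ofReal ?_
    have := hr.1
    nlinarith [sq_nonneg (‖deriv φ (circleMap 0 r θ)‖ - 1),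
      sq_nonneg (‖deriv φ (circleMap 0 r θ)‖)]

theorem mem_frontier_of_tendsto (h : IsConformalPair φ ψ G) {θ : ℝ} {p : ℂ}
    (hp : Tendsto (fun r => φ (circleMap 0 r θ)) (𝓝[<] 1) (𝓝 p)) : p ∈ frontier G := by
  have hev : ∀ᶠ r : ℝ in 𝓝[<] 1, r ∈ Ioo (0 : ℝ) 1 := Ioo_mem_nhdsLT (by norm_num)
  rw [h.isOpen.frontier_eq]
  refine ⟨mem_closure_of_tendsto hp (hev.mono fun r hr => h.mapsTo (circleMap_mem_ball hr θ)), ?_⟩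
  intro hpG
  have h1 := ((h.continuousOn_symm.continuousAt (h.isOpen.mem_nhds hpG)).tendsto.comp hp).norm
  have h2 : Tendsto (fun r : ℝ => r) (𝓝[<] 1) (𝓝 ‖ψ p‖) := by
    refine h1.congr' (hev.mono fun r hr => ?_)
    simp only [Function.comp_apply]
    rw [h.symm_apply (circleMap_mem_ball hr θ), norm_circleMap_zero, abs_of_pos hr.1]
  have h3 : ‖ψ p‖ = 1 := tendsto_nhds_unique h2 (tendsto_id.mono_left nhdsWithin_le_nhds)
  have := h.mapsTo_symm hpG
  rw [mem_ball_zero_iff, h3] at this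
  exact lt_irrefl _ this

theorem ae_tendsto_boundaryValue (h : IsConformalPair φ ψ G) :
    ∀ᵐ θ ∂angleMeasure, boundaryValue φ θ ∈ frontier G ∧
      Tendsto (fun r => φ (circleMap 0 r θ)) (𝓝[<] 1) (𝓝 (boundaryValue φ θ)) := by
  filter_upwards [h.ae_exists_radial_limit] with θ hθ
  have := tendsto_nhds_limUnder hθ
  exact ⟨h.mem_frontier_of_tendsto this, this⟩

end IsConformalPair

/-! ### Integrals of Cauchy type -/

section CauchyType

variable {X : Type*} [MeasurableSpace X] {μ : Measure X} {k c : X → ℂ} {S : Set ℂ}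

theorem differentiableOn_integral_div_sub (hS : IsClosed S) (hk : Integrable k μ)
    (hc : AEStronglyMeasurable c μ) (hcS : ∀ᵐ x ∂μ, c x ∈ S) :
    DifferentiableOn ℂ (fun ζ => ∫ x, k x / (c x - ζ) ∂μ) Sᶜ := by
  intro ζ₀ hζ₀
  obtain ⟨ε, hε, hball⟩ := Metric.isOpen_iff.1 hS.isOpen_compl ζ₀ hζ₀
  have hlow : ∀ s ∈ S, ∀ ζ ∈ ball ζ₀ (ε / 2), ε / 2 ≤ ‖s - ζ‖ := by
    intro s hs ζ hζ
    have h1 : ε ≤ dist s ζ₀ := by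
      by_contra hlt
      exact hball (mem_ball.2 (not_le.1 hlt)) hs
    have h2 := dist_triangle s ζ ζ₀
    rw [mem_ball] at hζ
    rw [← dist_eq_norm]
    linarith
  have hm : ∀ ζ, AEStronglyMeasurable (fun x => k x / (c x - ζ)) μ := fun ζ =>
    hk.aestronglyMeasurable.div₀ (hc.sub aestronglyMeasurable_const)
  refine ((hasDerivAt_integral_of_dominated_loc_of_deriv_le (μ := μ)
    (F := fun ζ x => k x / (c x - ζ)) (F' := fun ζ x => k x / (c x - ζ) ^ 2)
    (bound := fun x => ‖k x‖ * ((ε / 2) ^ 2)⁻¹)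
    (ball_mem_nhds ζ₀ (half_pos hε)) (Eventually.of_forall hm) ?_ ?_ ?_ ?_ ?_).2
    ).differentiableAt.differentiableWithinAt
  · refine (hk.norm.mul_const (ε / 2)⁻¹).mono' (hm ζ₀) ?_
    filter_upwards [hcS] with x hx
    rw [norm_div, div_eq_mul_inv]
    gcongr
    exact hlow _ hx _ (mem_ball_self (half_pos hε))
  · exact hk.aestronglyMeasurable.div₀ ((hc.sub aestronglyMeasurable_const).pow 2)
  · filter_upwards [hcS] with x hx ζ hζ
    rw [norm_div, div_eq_mul_inv, norm_pow]
    gcongr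
    exact hlow _ hx _ hζ
  · exact hk.norm.mul_const _
  · filter_upwards [hcS] with x hx ζ hζ
    have hne : c x - ζ ≠ 0 := by
      intro h0
      have := hlow _ hx _ hζ
      rw [h0, norm_zero] at this
      linarith
    have h1 : HasDerivAt (fun ζ => c x - ζ) (-1) ζ := by
      simpa using (hasDerivAt_id ζ).const_sub (c x)
    have h2 := (h1.inv hne).const_mul (k x)
    simpa [div_eq_mul_inv] using h2

theorem tendsto_integral_div_sub (hS : Bornology.IsBounded S) (hk : Integrable k μ)
    (hc : AEStronglyMeasurable c μ) (hcS : ∀ᵐ x ∂μ, c x ∈ S) :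
    Tendsto (fun ζ => ∫ x, k x / (c x - ζ) ∂μ) (Bornology.cobounded ℂ) (𝓝 0) := by
  obtain ⟨M, hM⟩ := hS.subset_ball 0
  have : (Bornology.cobounded ℂ).IsCountablyGenerated := by
    rw [← comap_norm_atTop]; infer_instance
  have := tendsto_integral_filter_of_dominated_convergence (μ := μ)
    (l := Bornology.cobounded ℂ) (F := fun ζ x => k x / (c x - ζ)) (f := fun _ => 0)
    (fun x => ‖k x‖)
    (Eventually.of_forall fun ζ => hk.aestronglyMeasurable.div₀ (hc.sub aestronglyMeasurable_const))
    ?_ hk.norm ?_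
  · simpa using this
  · have hev : ∀ᶠ ζ : ℂ in Bornology.cobounded ℂ, M + 1 ≤ ‖ζ‖ :=
      tendsto_norm_cobounded_atTop.eventually_ge_atTop _
    filter_upwards [hev] with ζ hζ
    filter_upwards [hcS] with x hx
    rw [norm_div]
    refine div_le_self (norm_nonneg _) ?_
    have h1 := hM hx
    rw [mem_ball_zero_iff] at h1
    have h2 := norm_sub_norm_le ζ (c x)
    rw [norm_sub_rev] at h2
    linarith
  · refine Eventually.of_forall fun x => ?_
    have h1 : Tendsto (fun ζ : ℂ => c x - ζ) (Bornology.cobounded ℂ) (Bornology.cobounded ℂ) :=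
      tendsto_const_sub_cobounded (c x)
    simpa [div_eq_mul_inv] using (tendsto_inv₀_cobounded.comp h1).const_mul (k x)

end CauchyType

theorem circleIntegral_eq_integral_angleMeasure (f : ℂ → ℂ) (r : ℝ) :
    ∮ w in C(0, r), f w = ∫ θ, circleMap 0 r θ * I * f (circleMap 0 r θ) ∂angleMeasure := by
  rw [circleIntegral, intervalIntegral.integral_of_le Real.two_pi_pos.le]
  simp [angleMeasure]

theorem sphere_subset_annulus {r₀ r : ℝ} (hr : r ∈ Ioo r₀ 1) :
    sphere (0 : ℂ) r ⊆ ball 0 1 \ closedBall 0 r₀ := by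
  intro w hw
  rw [mem_sphere_zero_iff_norm] at hw
  simp [hw, hr.1, hr.2]

theorem circleMap_mem_annulus {r₀ r : ℝ} (h0 : 0 ≤ r₀) (hr : r ∈ Ioo r₀ 1) (θ : ℝ) :
    circleMap 0 r θ ∈ ball (0 : ℂ) 1 \ closedBall 0 r₀ :=
  sphere_subset_annulus hr (circleMap_mem_sphere 0 (h0.trans hr.1.le) θ)

theorem isOpen_annulus (r₀ : ℝ) : IsOpen (ball (0 : ℂ) 1 \ closedBall 0 r₀) :=
  isOpen_ball.sdiff isClosed_closedBall

theorem circleIntegral_eq_of_differentiableOn_annulus {F : ℂ → ℂ} {r₀ r r' : ℝ} (h0 : 0 ≤ r₀)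
    (hF : DifferentiableOn ℂ F (ball 0 1 \ closedBall 0 r₀)) (hr : r₀ < r) (hrr : r ≤ r')
    (hr' : r' < 1) : ∮ w in C(0, r'), F w = ∮ w in C(0, r), F w := by
  refine circleIntegral_eq_of_differentiable_on_annulus_off_countable (h0.trans_lt hr) hrr
    countable_empty (hF.continuousOn.mono ?_) ?_
  · intro w hw
    simp only [Set.mem_sdiff, mem_closedBall_zero_iff, mem_ball_zero_iff, not_lt, not_le] at hw ⊢
    exact ⟨hw.1.trans_lt hr', hr.trans_le hw.2⟩
  · intro w hw
    refine hF.differentiableAt ((isOpen_annulus r₀).mem_nhds ?_)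
    have := hw.1
    simp only [Set.mem_sdiff, mem_closedBall_zero_iff, mem_ball_zero_iff, not_le] at this ⊢
    exact ⟨this.1.trans hr', hr.trans this.2⟩

/-- The residue theorem in an annulus for a function with one simple pole. -/
theorem circleIntegral_sub_circleIntegral_div_sub {T : ℂ → ℂ} {r₀ r r' : ℝ} {w₀ : ℂ} (h0 : 0 ≤ r₀)
    (hT : DifferentiableOn ℂ T (ball 0 1 \ closedBall 0 r₀)) (hr : r₀ < r) (hrw : r < ‖w₀‖)
    (hwr : ‖w₀‖ < r') (hr' : r' < 1) :
    (∮ w in C(0, r'), T w / (w - w₀)) = (∮ w in C(0, r), T w / (w - w₀)) +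
      2 * Real.pi * I * T w₀ := by
  have hw₀ : ball (0 : ℂ) 1 \ closedBall 0 r₀ ∈ 𝓝 w₀ := by
    refine (isOpen_annulus r₀).mem_nhds ?_
    simp only [Set.mem_sdiff, mem_closedBall_zero_iff, mem_ball_zero_iff, not_le]
    exact ⟨hwr.trans hr', hr.trans hrw⟩
  have hD := (Complex.differentiableOn_dslope hw₀).2 hT
  have key : ∀ s ∈ Ioo r₀ 1, s ≠ ‖w₀‖ → (∮ w in C(0, s), T w / (w - w₀)) =
      (∮ w in C(0, s), dslope T w₀ w) + T w₀ * ∮ w in C(0, s), (w - w₀)⁻¹ := by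
    intro s hs hne
    have hs0 : 0 ≤ s := h0.trans hs.1.le
    have hne' : ∀ w ∈ sphere (0 : ℂ) s, w - w₀ ≠ 0 := by
      intro w hw h
      rw [mem_sphere_zero_iff_norm, sub_eq_zero.1 h] at hw
      exact hne hw.symm
    have hci : ContinuousOn (fun w : ℂ => T w₀ * (w - w₀)⁻¹) (sphere 0 s) :=
      continuousOn_const.mul ((continuousOn_id.sub continuousOn_const).inv₀ hne')
    rw [← circleIntegral.integral_const_mul, ← circleIntegral.integral_add]
    · refine circleIntegral.integral_congr hs0 fun w hw => ?_
      have h1 := sub_smul_dslope T w₀ w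
      rw [smul_eq_mul] at h1
      have h2 := hne' w hw
      field_simp
      rw [h1]; ring
    · exact (hD.continuousOn.mono (sphere_subset_annulus hs)).circleIntegrable hs0
    · exact hci.circleIntegrable hs0
  have hr0 : 0 ≤ r := h0.trans hr.le
  rw [key r' ⟨hr.trans (hrw.trans hwr), hr'⟩ hwr.ne', key r ⟨hr, hrw.trans (hwr.trans hr')⟩ hrw.ne,
    circleIntegral_eq_of_differentiableOn_annulus h0 hD hr (hrw.trans hwr).le hr',
    circleIntegral.integral_sub_inv_of_mem_ball (by rwa [mem_ball_zero_iff])]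
  have : (∮ w in C(0, r), (w - w₀)⁻¹) = 0 := by
    have hne : ∀ w ∈ closedBall (0 : ℂ) r, w - w₀ ≠ 0 := by
      intro w hw h
      rw [mem_closedBall_zero_iff, sub_eq_zero.1 h] at hw
      exact absurd hw (not_le.2 hrw)
    refine circleIntegral_eq_zero_of_differentiable_on_off_countable hr0 countable_empty
      ((continuousOn_id.sub continuousOn_const).inv₀ hne) fun w hw => ?_
    exact (differentiableAt_id.sub_const _).inv (hne w (ball_subset_closedBall hw.1))
  rw [this]; ring

namespace IsConformalPair

variable {φ ψ γ : ℂ → ℂ} {G K : Set ℂ} {r₀ : ℝ}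

theorem notMem_of_mem_annulus (h : IsConformalPair φ ψ G) (hr₀ : r₀ ≤ 1)
    (hK : K ⊆ φ '' ball 0 r₀) {w : ℂ}
    (hw : w ∈ ball (0 : ℂ) 1 \ closedBall 0 r₀) : φ w ∉ K := by
  intro hm
  obtain ⟨v, hv, hvw⟩ := hK hm
  have := h.injOn (ball_subset_ball hr₀ hv) hw.1 hvw
  subst this
  exact hw.2 (ball_subset_closedBall hv)

theorem differentiableOn_comp_annulus (h : IsConformalPair φ ψ G) (hr₀ : r₀ ≤ 1)
    (hK : K ⊆ φ '' ball 0 r₀) (hγ : DifferentiableOn ℂ γ Kᶜ) :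
    DifferentiableOn ℂ (fun w => γ (φ w)) (ball 0 1 \ closedBall 0 r₀) :=
  hγ.comp (h.differentiableOn.mono sdiff_subset) fun _ hw => h.notMem_of_mem_annulus hr₀ hK hw

/-- Differentiability in `ζ` and decay at `∞` of the Cauchy integral of `γ` over the image of the
circle of radius `r`. -/
theorem circleIntegral_cauchy_aux (h : IsConformalPair φ ψ G) (h0 : 0 ≤ r₀)
    (hK : K ⊆ φ '' ball 0 r₀) (hγ : DifferentiableOn ℂ γ Kᶜ) {r : ℝ} (hr : r ∈ Ioo r₀ 1) :
    DifferentiableOn ℂ (fun ζ => ∮ w in C(0, r), γ (φ w) * deriv φ w / (φ w - ζ))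
      (φ '' sphere 0 r)ᶜ ∧
    Tendsto (fun ζ => ∮ w in C(0, r), γ (φ w) * deriv φ w / (φ w - ζ))
      (Bornology.cobounded ℂ) (𝓝 0) := by
  have hsub : sphere (0 : ℂ) r ⊆ ball 0 1 :=
    (sphere_subset_annulus hr).trans sdiff_subset
  have hcm : ∀ θ, circleMap 0 r θ ∈ sphere (0 : ℂ) r := circleMap_mem_sphere 0 (h0.trans hr.1.le)
  have hcφ : Continuous fun θ => φ (circleMap 0 r θ) :=
    (h.differentiableOn.continuousOn.mono hsub).comp_continuous (continuous_circleMap 0 r) hcm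
  have hcd : Continuous fun θ => deriv φ (circleMap 0 r θ) :=
    (h.differentiableOn_deriv.continuousOn.mono hsub).comp_continuous (continuous_circleMap 0 r) hcm
  have hcγ : Continuous fun θ => γ (φ (circleMap 0 r θ)) :=
    ((h.differentiableOn_comp_annulus (hr.1.trans hr.2).le hK hγ).continuousOn.mono
      (sphere_subset_annulus hr)).comp_continuous (continuous_circleMap 0 r) hcm
  have hcpt : IsCompact (φ '' sphere 0 r) :=
    (isCompact_sphere 0 r).image_of_continuousOn (h.differentiableOn.continuousOn.mono hsub)
  have hk : Integrable (fun θ => circleMap 0 r θ * I *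
      (γ (φ (circleMap 0 r θ)) * deriv φ (circleMap 0 r θ))) angleMeasure := by
    have : Continuous (fun θ => circleMap 0 r θ * I *
      (γ (φ (circleMap 0 r θ)) * deriv φ (circleMap 0 r θ))) :=
      ((continuous_circleMap 0 r).mul continuous_const).mul (hcγ.mul hcd)
    exact this.integrableOn_Ioc
  have e : (fun ζ => ∮ w in C(0, r), γ (φ w) * deriv φ w / (φ w - ζ)) = fun ζ =>
      ∫ θ, circleMap 0 r θ * I * (γ (φ (circleMap 0 r θ)) * deriv φ (circleMap 0 r θ)) /
        (φ (circleMap 0 r θ) - ζ) ∂angleMeasure := by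
    ext ζ
    rw [circleIntegral_eq_integral_angleMeasure]
    simp_rw [mul_div_assoc]
  have hmem : ∀ᵐ θ ∂angleMeasure, φ (circleMap 0 r θ) ∈ φ '' sphere 0 r :=
    Eventually.of_forall fun θ => mem_image_of_mem φ (hcm θ)
  rw [e]
  exact ⟨differentiableOn_integral_div_sub hcpt.isClosed hk hcφ.aestronglyMeasurable hmem,
    tendsto_integral_div_sub hcpt.isBounded hk hcφ.aestronglyMeasurable hmem⟩

/-- **Cauchy's formula for the exterior of a curve.** Let `Γ_s(ζ)` be the integral over the image
of the circle of radius `s`. For `r < r'` the function `Γ_{r'} - Γ_r` equals `2πi γ` between the two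
curves, by the residue theorem, so `-Γ_{r'}` inside the outer curve and `-Γ_r - 2πi γ` outside the
inner curve together form an entire function vanishing at infinity. -/
theorem exterior_cauchy_formula (h : IsConformalPair φ ψ G) (h0 : 0 ≤ r₀)
    (hK : K ⊆ φ '' ball 0 r₀) (hγ : DifferentiableOn ℂ γ Kᶜ)
    (hγ0 : Tendsto γ (Bornology.cobounded ℂ) (𝓝 0)) {r : ℝ} (hr : r ∈ Ioo r₀ 1) {ζ : ℂ}
    (hζ : ζ ∉ G) :
    ∮ w in C(0, r), γ (φ w) * deriv φ w / (φ w - ζ) = -(2 * Real.pi * I * γ ζ) := by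
  obtain ⟨r', hrr', hr'⟩ := exists_between hr.2
  have hr₀1 : r₀ ≤ 1 := (hr.1.trans hr.2).le
  have hr'0 : 0 < r' := h0.trans_lt (hr.1.trans hrr')
  set Γ : ℝ → ℂ → ℂ := fun s ζ => ∮ w in C(0, s), γ (φ w) * deriv φ w / (φ w - ζ) with hΓ
  obtain ⟨hd1, ht1⟩ := h.circleIntegral_cauchy_aux h0 hK hγ hr
  obtain ⟨hd2, -⟩ := h.circleIntegral_cauchy_aux h0 hK hγ ⟨hr.1.trans hrr', hr'⟩
  set A : Set ℂ := φ '' ball 0 r' with hA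
  have hcb : closedBall (0 : ℂ) r ⊆ ball 0 1 := closedBall_subset_ball hr.2
  have hAo : IsOpen A := h.isOpen_image (ball_subset_ball hr'.le) isOpen_ball
  set C : Set ℂ := φ '' closedBall 0 r with hC
  have hCc : IsClosed C := ((isCompact_closedBall 0 r).image_of_continuousOn
    (h.differentiableOn.continuousOn.mono hcb)).isClosed
  have hCA : C ⊆ A := image_mono (closedBall_subset_ball hrr')
  have hAG : A ⊆ G := by
    rw [← h.image_ball]; exact image_mono (ball_subset_ball hr'.le)
  -- the two definitions agree between the curves
  have hagree : ∀ z ∈ A \ C, -Γ r' z = -Γ r z - 2 * Real.pi * I * γ z := by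
    rintro z ⟨⟨w₀, hw₀, rfl⟩, hzC⟩
    have hw1 : r < ‖w₀‖ := by
      by_contra hle
      exact hzC ⟨w₀, mem_closedBall_zero_iff.2 (not_lt.1 hle), rfl⟩
    rw [mem_ball_zero_iff] at hw₀
    have hw₀D : w₀ ∈ ball (0 : ℂ) 1 := mem_ball_zero_iff.2 (hw₀.trans hr')
    set T : ℂ → ℂ := fun w => γ (φ w) * deriv φ w * (dslope φ w₀ w)⁻¹ with hT
    have hTd : DifferentiableOn ℂ T (ball 0 1 \ closedBall 0 r₀) :=
      ((h.differentiableOn_comp_annulus hr₀1 hK hγ).mul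
        (h.differentiableOn_deriv.mono sdiff_subset)).mul
        (((h.differentiableOn_dslope hw₀D).mono sdiff_subset).inv fun w hw =>
          h.dslope_ne_zero hw₀D hw.1)
    have e : ∀ s, Γ s (φ w₀) = ∮ w in C(0, s), T w / (w - w₀) := by
      intro s
      simp only [hΓ, hT]
      congr 1 with w
      rw [div_eq_mul_inv, inv_sub_eq_inv_mul_inv_dslope]
      ring
    rw [e, e, circleIntegral_sub_circleIntegral_div_sub h0 hTd hr.1 hw1 hw₀ hr']
    have : T w₀ = γ (φ w₀) := by
      simp only [hT]
      rw [dslope_same, mul_assoc, mul_inv_cancel₀ (h.deriv_ne_zero hw₀D), mul_one]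
    rw [this]; ring
  classical
  set E : ℂ → ℂ := fun z => if z ∈ A then -Γ r' z else -Γ r z - 2 * Real.pi * I * γ z with hE
  have hE1 : ∀ z ∈ A, E z = -Γ r' z := fun z hz => if_pos hz
  have hE2 : ∀ z ∈ Cᶜ, E z = -Γ r z - 2 * Real.pi * I * γ z := by
    intro z hz
    by_cases hzA : z ∈ A
    · rw [hE1 z hzA]; exact hagree z ⟨hzA, hz⟩
    · exact if_neg hzA
  have hEd : Differentiable ℂ E := by
    intro z
    by_cases hz : z ∈ A
    · refine DifferentiableAt.congr_of_eventuallyEq ?_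
        (eventually_of_mem (hAo.mem_nhds hz) hE1)
      refine (hd2.differentiableAt (mem_of_superset (hAo.mem_nhds hz) ?_)).neg
      rintro _ ⟨w, hw, rfl⟩ ⟨v, hv, hvw⟩
      have hv1 : v ∈ ball (0 : ℂ) 1 := by
        rw [mem_sphere_zero_iff_norm] at hv
        rw [mem_ball_zero_iff, hv]; exact hr'
      have := h.injOn hv1 (ball_subset_ball hr'.le hw) hvw
      subst this
      rw [mem_sphere_zero_iff_norm] at hv
      rw [mem_ball_zero_iff, hv] at hw
      exact lt_irrefl _ hw
    · have hzC : z ∈ Cᶜ := fun hc => hz (hCA hc)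
      refine DifferentiableAt.congr_of_eventuallyEq ?_
        (eventually_of_mem (hCc.isOpen_compl.mem_nhds hzC) hE2)
      refine (hd1.differentiableAt (mem_of_superset (hCc.isOpen_compl.mem_nhds hzC) ?_)).neg.sub
        ((hγ.differentiableAt (mem_of_superset (hCc.isOpen_compl.mem_nhds hzC) ?_)).const_mul _)
      · exact compl_subset_compl.2 (image_mono sphere_subset_closedBall)
      · refine compl_subset_compl.2 (hK.trans (image_mono ?_))
        exact (ball_subset_ball hr.1.le).trans ball_subset_closedBall
  have hEt : Tendsto E (cocompact ℂ) (𝓝 0) := by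
    rw [← Metric.cobounded_eq_cocompact]
    have := (ht1.neg.sub (hγ0.const_mul (2 * Real.pi * I)))
    rw [neg_zero, mul_zero, sub_zero] at this
    refine this.congr' ?_
    have hCb : Bornology.IsBounded C := h.isBounded.subset (hCA.trans hAG)
    filter_upwards [Bornology.isBounded_def.1 hCb] with z hz using (hE2 z hz).symm
  have h1 := hEd.apply_eq_of_tendsto_cocompact ζ hEt
  rw [hE2 ζ fun hc => hζ (hAG (hCA hc))] at h1
  linear_combination -h1

end IsConformalPair

/-! ### Fourier coefficients of boundary values -/

theorem fourierCoeffOn_neg_succ (f : ℝ → ℂ) (k : ℕ) :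
    fourierCoeffOn Real.two_pi_pos f (-((k : ℤ) + 1)) =
      (2 * Real.pi * I)⁻¹ *
        ∫ θ, circleMap 0 1 θ * I * (f θ * circleMap 0 1 θ ^ k) ∂angleMeasure := by
  rw [fourierCoeffOn_eq_integral, intervalIntegral.integral_of_le Real.two_pi_pos.le, neg_neg,
    ← integral_const_mul, angleMeasure, real_smul, ← integral_const_mul]
  refine integral_congr_ae (Eventually.of_forall fun θ => ?_)
  simp only [fourier_coe_apply, smul_eq_mul, circleMap, zero_add, ofReal_one, one_mul]
  have e : cexp (2 * Real.pi * I * ((k : ℤ) + 1 : ℤ) * θ / ((2 * Real.pi - 0 : ℝ) : ℂ)) =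
      cexp (θ * I) * cexp (θ * I) ^ k := by
    rw [← Complex.exp_nat_mul, ← Complex.exp_add]
    congr 1
    have : (Real.pi : ℂ) ≠ 0 := by exact_mod_cast Real.pi_ne_zero
    push_cast
    field_simp
    ring
  rw [e]
  have : (Real.pi : ℂ) ≠ 0 := by exact_mod_cast Real.pi_ne_zero
  push_cast
  field_simp
  simp

namespace IsConformalPair

variable {φ ψ γ : ℂ → ℂ} {G K : Set ℂ} {r₀ : ℝ}

theorem subset_of_subset_image_ball (h : IsConformalPair φ ψ G) (hr₀ : r₀ ≤ 1)
    (hK : K ⊆ φ '' ball 0 r₀) : K ⊆ G := by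
  rw [← h.image_ball]
  exact hK.trans (image_mono (ball_subset_ball hr₀))

theorem exists_bound_near_boundary (h : IsConformalPair φ ψ G) (hK : K ⊆ φ '' ball 0 r₀)
    (hγ : DifferentiableOn ℂ γ Kᶜ) {r₁ : ℝ} (hr₁ : r₁ ∈ Ioo r₀ 1) :
    ∃ M, (∀ w ∈ ball (0 : ℂ) 1, r₁ ≤ ‖w‖ → ‖γ (φ w)‖ ≤ M) ∧ ∀ p ∈ frontier G, ‖γ p‖ ≤ M := by
  have hQ : IsCompact (closure G \ φ '' ball 0 r₁) :=
    h.isBounded.isCompact_closure.diff (h.isOpen_image (ball_subset_ball hr₁.2.le) isOpen_ball)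
  have hsub : closure G \ φ '' ball 0 r₁ ⊆ Kᶜ := fun z hz hzK =>
    hz.2 (image_mono (ball_subset_ball hr₁.1.le) (hK hzK))
  obtain ⟨M, hM⟩ := hQ.exists_bound_of_continuousOn (hγ.continuousOn.mono hsub)
  refine ⟨M, fun w hw hr => hM _ ⟨subset_closure (h.mapsTo hw), ?_⟩, fun p hp => hM _ ⟨hp.1, ?_⟩⟩
  · rintro ⟨v, hv, hvw⟩
    have := h.injOn (ball_subset_ball hr₁.2.le hv) hw hvw
    subst this
    rw [mem_ball_zero_iff] at hv
    exact absurd hr (not_le.2 hv)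
  · intro hpi
    rw [h.isOpen.frontier_eq] at hp
    rw [← h.image_ball] at hp
    exact hp.2 (image_mono (ball_subset_ball hr₁.2.le) hpi)

theorem ae_tendsto_comp_boundaryValue (h : IsConformalPair φ ψ G) (hr₀ : r₀ ≤ 1)
    (hK : K ⊆ φ '' ball 0 r₀) (hKc : IsClosed K) (hγ : DifferentiableOn ℂ γ Kᶜ) :
    ∀ᵐ θ ∂angleMeasure, Tendsto (fun r => γ (φ (circleMap 0 r θ))) (𝓝[<] 1)
      (𝓝 (γ (boundaryValue φ θ))) := by
  filter_upwards [h.ae_tendsto_boundaryValue] with θ hθ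
  have hp : boundaryValue φ θ ∈ Kᶜ := by
    intro hp
    have := hθ.1
    rw [h.isOpen.frontier_eq] at this
    exact this.2 (h.subset_of_subset_image_ball hr₀ hK hp)
  exact ((hγ.differentiableAt (hKc.isOpen_compl.mem_nhds hp)).continuousAt.tendsto).comp hθ.2

theorem continuous_comp_circleMap (h : IsConformalPair φ ψ G) (h0 : 0 ≤ r₀)
    (hK : K ⊆ φ '' ball 0 r₀) (hγ : DifferentiableOn ℂ γ Kᶜ) {r : ℝ} (hr : r ∈ Ioo r₀ 1) :
    Continuous fun θ => γ (φ (circleMap 0 r θ)) :=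
  (h.differentiableOn_comp_annulus (hr.1.trans hr.2).le hK hγ).continuousOn.comp_continuous
    (continuous_circleMap 0 r) (circleMap_mem_annulus h0 hr)

/-- The boundary function is bounded, and measurable as an almost everywhere limit of the continuous
functions `θ ↦ γ(φ(r e^{iθ}))`. -/
theorem integrable_comp_boundaryValue (h : IsConformalPair φ ψ G) (h0 : 0 ≤ r₀) (hr₀ : r₀ < 1)
    (hK : K ⊆ φ '' ball 0 r₀) (hKc : IsClosed K) (hγ : DifferentiableOn ℂ γ Kᶜ) :
    Integrable (fun θ => γ (boundaryValue φ θ)) angleMeasure := by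
  obtain ⟨r₁, hr₁⟩ := exists_between hr₀
  obtain ⟨M, -, hM⟩ := h.exists_bound_near_boundary hK hγ hr₁
  have hlim := h.ae_tendsto_comp_boundaryValue hr₀.le hK hKc hγ
  obtain ⟨s, -, hs, hst⟩ := exists_seq_strictMono_tendsto' hr₀
  have hst' : Tendsto s atTop (𝓝[<] 1) :=
    tendsto_nhdsWithin_iff.2 ⟨hst, Eventually.of_forall fun n => (hs n).2⟩
  have hm : AEStronglyMeasurable (fun θ => γ (boundaryValue φ θ)) angleMeasure :=
    aestronglyMeasurable_of_tendsto_ae atTop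
      (fun n => (h.continuous_comp_circleMap h0 hK hγ (hs n)).aestronglyMeasurable)
      (hlim.mono fun θ hθ => hθ.comp hst')
  exact (integrable_const M).mono' hm (h.ae_tendsto_boundaryValue.mono fun θ hθ => hM _ hθ.1)

/-- The Fourier coefficients of negative index of the boundary function are the coefficients of the
Laurent series of `γ ∘ φ`, hence integrals over a circle of any radius close to `1`. -/
theorem fourierCoeffOn_comp_boundaryValue (h : IsConformalPair φ ψ G) (h0 : 0 ≤ r₀)
    (hK : K ⊆ φ '' ball 0 r₀) (hKc : IsClosed K) (hγ : DifferentiableOn ℂ γ Kᶜ) {r : ℝ}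
    (hr : r ∈ Ioo r₀ 1) (k : ℕ) :
    fourierCoeffOn Real.two_pi_pos (fun θ => γ (boundaryValue φ θ)) (-((k : ℤ) + 1)) =
      (2 * Real.pi * I)⁻¹ * ∮ w in C(0, r), γ (φ w) * w ^ k := by
  have hr₀ : r₀ < 1 := hr.1.trans hr.2
  rw [fourierCoeffOn_neg_succ]
  congr 1
  obtain ⟨M, hM, -⟩ := h.exists_bound_near_boundary hK hγ hr
  have hev : ∀ᶠ s : ℝ in 𝓝[<] 1, s ∈ Ioo r 1 := Ioo_mem_nhdsLT hr.2
  have hlim := tendsto_integral_filter_of_dominated_convergence (μ := angleMeasure)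
    (l := 𝓝[<] (1 : ℝ))
    (F := fun s θ => circleMap 0 s θ * I * (γ (φ (circleMap 0 s θ)) * circleMap 0 s θ ^ k))
    (f := fun θ => circleMap 0 1 θ * I * (γ (boundaryValue φ θ) * circleMap 0 1 θ ^ k))
    (fun _ => M) ?_ ?_ (integrable_const M) ?_
  · refine tendsto_nhds_unique hlim ?_
    refine tendsto_const_nhds.congr' ?_
    filter_upwards [hev] with s hs
    rw [← circleIntegral_eq_integral_angleMeasure (fun w => γ (φ w) * w ^ k)]
    exact (circleIntegral_eq_of_differentiableOn_annulus h0
      ((h.differentiableOn_comp_annulus hr₀.le hK hγ).mul (by fun_prop)) hr.1 hs.1.le hs.2).symm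
  · filter_upwards [hev] with s hs
    have := h.continuous_comp_circleMap h0 hK hγ ⟨hr.1.trans hs.1, hs.2⟩
    have hc := continuous_circleMap 0 s
    exact ((hc.mul continuous_const).mul (this.mul (hc.pow k))).aestronglyMeasurable
  · filter_upwards [hev] with s hs
    refine Eventually.of_forall fun θ => ?_
    have hs0 : 0 ≤ s := (h0.trans hr.1.le).trans hs.1.le
    have hn : ‖circleMap 0 s θ‖ = s := by rw [norm_circleMap_zero, abs_of_nonneg hs0]
    have hMb : ‖γ (φ (circleMap 0 s θ))‖ ≤ M :=
      hM _ (by rw [mem_ball_zero_iff, hn]; exact hs.2) (by rw [hn]; exact hs.1.le)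
    have hM0 : 0 ≤ M := (norm_nonneg _).trans hMb
    rw [norm_mul, norm_mul, norm_mul, norm_pow, hn, norm_I, mul_one]
    calc s * (‖γ (φ (circleMap 0 s θ))‖ * s ^ k) ≤ 1 * (M * 1) := by
          gcongr
          · exact hs.2.le
          · exact pow_le_one₀ hs0 hs.2.le
      _ = M := by ring
  · filter_upwards [h.ae_tendsto_comp_boundaryValue hr₀.le hK hKc hγ] with θ hθ
    have hc : Tendsto (fun s => circleMap 0 s θ) (𝓝[<] 1) (𝓝 (circleMap 0 1 θ)) := by
      have : Continuous fun s => circleMap 0 s θ := by unfold circleMap; fun_prop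
      exact (this.tendsto 1).mono_left nhdsWithin_le_nhds
    exact (hc.mul_const I).mul (hθ.mul (hc.pow k))

end IsConformalPair

/-! ### Taylor coefficients -/

/-- The Taylor coefficient of index `k` at the origin of a function analytic in the unit disk. -/
noncomputable def taylorCoeff (F : ℂ → ℂ) (k : ℕ) : ℂ :=
  (2 * Real.pi * I)⁻¹ * ∮ w in C(0, 1 / 2), F w / w ^ (k + 1)

section Taylor

variable {F : ℂ → ℂ}

theorem taylorCoeff_eq (hF : DifferentiableOn ℂ F (ball 0 1)) {r : ℝ} (hr : r ∈ Ioo (0 : ℝ) 1)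
    (k : ℕ) : (2 * Real.pi * I)⁻¹ * ∮ w in C(0, r), F w / w ^ (k + 1) = taylorCoeff F k := by
  rw [taylorCoeff]
  congr 1
  have hd : DifferentiableOn ℂ (fun w => F w / w ^ (k + 1)) (ball 0 1 \ closedBall 0 0) := by
    refine (hF.mono sdiff_subset).div (by fun_prop) fun w hw => pow_ne_zero _ ?_
    rintro rfl
    exact hw.2 (by simp)
  rcases le_total r (1 / 2) with h | h
  · exact (circleIntegral_eq_of_differentiableOn_annulus le_rfl hd hr.1 h (by norm_num)).symm
  · exact circleIntegral_eq_of_differentiableOn_annulus le_rfl hd (by norm_num) h hr.2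

theorem hasSum_taylorCoeff (hF : DifferentiableOn ℂ F (ball 0 1)) {w : ℂ}
    (hw : w ∈ ball (0 : ℂ) 1) : HasSum (fun k => taylorCoeff F k * w ^ k) (F w) := by
  rw [mem_ball_zero_iff] at hw
  obtain ⟨r, hwr, hr1⟩ := exists_between hw
  have hr0 : 0 < r := (norm_nonneg w).trans_lt hwr
  have hd : DifferentiableOn ℂ F (closedBall 0 r) := hF.mono (closedBall_subset_ball hr1)
  have hci : CircleIntegrable F 0 r :=
    (hd.continuousOn.mono sphere_subset_closedBall).circleIntegrable hr0.le
  have := hasSum_cauchyPowerSeries_integral hci hwr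
  rw [zero_add, hd.circleIntegral_sub_inv_smul (by rwa [mem_ball_zero_iff]), inv_smul_smul₀
    (by simp [Real.pi_ne_zero])] at this
  refine this.congr_fun fun k => ?_
  rw [cauchyPowerSeries_apply, ← taylorCoeff_eq hF ⟨hr0, hr1⟩, smul_eq_mul, mul_assoc,
    mul_comm _ (w ^ k), ← circleIntegral.integral_const_mul]
  congr 2 with z
  simp only [sub_zero, smul_eq_mul, div_pow]
  rw [pow_succ]
  rcases eq_or_ne z 0 with rfl | hz
  · simp
  · field_simp

theorem taylorCoeff_pow (j k : ℕ) :
    taylorCoeff (fun w => w ^ j) k = if j = k then 1 else 0 := by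
  rw [taylorCoeff]
  have e : (∮ w in C((0 : ℂ), 1 / 2), w ^ j / w ^ (k + 1)) =
      ∮ w in C((0 : ℂ), 1 / 2), (w - 0) ^ ((j : ℤ) - k - 1) := by
    refine circleIntegral.integral_congr (by norm_num) fun w hw => ?_
    have hw0 : w ≠ 0 := by
      rintro rfl
      simp at hw
    simp only [sub_zero]
    rw [sub_sub, zpow_sub₀ hw0]
    norm_cast
  rw [e]
  split_ifs with h
  · subst h
    simp only [sub_self, zero_sub, zpow_neg_one]
    rw [circleIntegral.integral_sub_center_inv 0 (by norm_num), inv_mul_cancel₀]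
    simp [Real.pi_ne_zero]
  · rw [circleIntegral.integral_sub_zpow_of_ne (by omega), mul_zero]

theorem integral_circleMap_mul_conj_pow (hF : DifferentiableOn ℂ F (ball 0 1)) {r : ℝ}
    (hr : r ∈ Ioo (0 : ℝ) 1) (k : ℕ) :
    ∫ θ, F (circleMap 0 r θ) * conj (circleMap 0 r θ) ^ k ∂angleMeasure =
      2 * Real.pi * r ^ (2 * k) * taylorCoeff F k := by
  rw [← taylorCoeff_eq hF hr, circleIntegral_eq_integral_angleMeasure, ← mul_assoc,
    ← integral_const_mul]
  refine integral_congr_ae (Eventually.of_forall fun θ => ?_)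
  have hc : circleMap 0 r θ ≠ 0 := by
    rw [← norm_ne_zero_iff, norm_circleMap_zero]; exact (abs_pos.2 hr.1.ne').ne'
  have hcc : (r : ℂ) ^ 2 = circleMap 0 r θ * conj (circleMap 0 r θ) := by
    rw [mul_conj, normSq_eq_norm_sq, norm_circleMap_zero, sq_abs]; push_cast; rfl
  have hpi : (Real.pi : ℂ) ≠ 0 := by exact_mod_cast Real.pi_ne_zero
  have hI := I_ne_zero
  simp only
  rw [pow_mul, hcc, mul_pow]
  field_simp
  ring

end Taylor

/-! ### The weighted measure on the disk -/

/-- The hypotheses on the weight, in terms of the disk alone: positivity on `(0, 1]`,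
measurability, and integrability of `ω(1 - r)` with respect to `r dr` on `(0, 1)`. -/
structure IsDiskWeight (ω : ℝ → ℝ) : Prop where
  aemeasurable : AEMeasurable ω (volume.restrict (Ioc 0 1))
  pos : ∀ t ∈ Ioc (0 : ℝ) 1, 0 < ω t
  integrable : Integrable (fun r => ω (1 - r)) radialMeasure

/-- The measure `ω(1 - |w|) dm₂(w)` on the unit disk. -/
noncomputable def diskMeasure (ω : ℝ → ℝ) : Measure ℂ :=
  (volume.restrict (ball (0 : ℂ) 1)).withDensity (fun w => ENNReal.ofReal (ω (1 - ‖w‖)))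

theorem radialMeasure_absolutelyContinuous : radialMeasure ≪ volume.restrict (Ioo 0 1) :=
  withDensity_absolutelyContinuous _ _

theorem ae_radialMeasure : ∀ᵐ r ∂radialMeasure, r ∈ Ioo (0 : ℝ) 1 :=
  radialMeasure_absolutelyContinuous.ae_le (ae_restrict_mem measurableSet_Ioo)

theorem quasiMeasurePreserving_one_sub :
    Measure.QuasiMeasurePreserving (fun r : ℝ => 1 - r) radialMeasure
      (volume.restrict (Ioc 0 1)) := by
  refine ⟨by fun_prop, ?_⟩
  refine (radialMeasure_absolutelyContinuous.map (by fun_prop)).trans ?_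
  have hmp : MeasurePreserving (fun r : ℝ => 1 - r) (volume.restrict (Ioo 0 1))
      (volume.restrict (Ioo 0 1)) := by
    have := (Measure.measurePreserving_sub_left volume (1 : ℝ)).restrict_preimage
      (s := Ioo (0 : ℝ) 1) measurableSet_Ioo
    simpa using this
  rw [hmp.map_eq]
  exact Measure.absolutelyContinuous_of_le (Measure.restrict_mono Ioo_subset_Ioc_self le_rfl)

theorem ae_norm_circleMap : ∀ᵐ p : ℝ × ℝ ∂(radialMeasure.prod angleMeasure),
    p.1 ∈ Ioo (0 : ℝ) 1 ∧ ‖circleMap 0 p.1 p.2‖ = p.1 := by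
  have := Measure.quasiMeasurePreserving_fst (μ := radialMeasure) (ν := angleMeasure) |>.ae
    ae_radialMeasure
  filter_upwards [this] with p hp
  exact ⟨hp, by rw [norm_circleMap_zero, abs_of_pos hp.1]⟩

theorem quasiMeasurePreserving_one_sub_norm :
    Measure.QuasiMeasurePreserving (fun w : ℂ => 1 - ‖w‖) (volume.restrict (ball 0 1))
      (volume.restrict (Ioc 0 1)) := by
  refine ⟨by fun_prop, ?_⟩
  rw [← measurePreserving_circleMap.map_eq, Measure.map_map (by fun_prop)
    measurable_circleMap_uncurry]
  have e : Measure.map ((fun w : ℂ => 1 - ‖w‖) ∘ fun p : ℝ × ℝ => circleMap 0 p.1 p.2)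
      (radialMeasure.prod angleMeasure) =
      Measure.map ((fun r : ℝ => 1 - r) ∘ Prod.fst) (radialMeasure.prod angleMeasure) := by
    refine Measure.map_congr ?_
    filter_upwards [ae_norm_circleMap] with p hp
    simp [hp.2]
  rw [e]
  exact (quasiMeasurePreserving_one_sub.comp
    Measure.quasiMeasurePreserving_fst).absolutelyContinuous

theorem lintegral_ball_eq_polar {f : ℂ → ENNReal}
    (hf : AEMeasurable f (volume.restrict (ball 0 1))) :
    ∫⁻ w in ball 0 1, f w = ∫⁻ r, ∫⁻ θ, f (circleMap 0 r θ) ∂angleMeasure ∂radialMeasure := by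
  rw [← measurePreserving_circleMap.map_eq] at hf ⊢
  rw [lintegral_map' hf measurable_circleMap_uncurry.aemeasurable]
  exact lintegral_prod _ (hf.comp_aemeasurable measurable_circleMap_uncurry.aemeasurable)

theorem integral_ball_eq_polar {f : ℂ → ℂ} (hf : IntegrableOn f (ball 0 1)) :
    ∫ w in ball 0 1, f w = ∫ r, ∫ θ, f (circleMap 0 r θ) ∂angleMeasure ∂radialMeasure := by
  rw [IntegrableOn, ← measurePreserving_circleMap.map_eq] at hf
  rw [← measurePreserving_circleMap.map_eq,
    integral_map measurable_circleMap_uncurry.aemeasurable hf.aestronglyMeasurable]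
  exact integral_prod _ (hf.comp_aemeasurable measurable_circleMap_uncurry.aemeasurable)

namespace IsDiskWeight

variable {ω : ℝ → ℝ}

theorem aemeasurable_comp_norm (hω : AEMeasurable ω (volume.restrict (Ioc 0 1))) :
    AEMeasurable (fun w : ℂ => ω (1 - ‖w‖)) (volume.restrict (ball 0 1)) :=
  hω.comp_quasiMeasurePreserving quasiMeasurePreserving_one_sub_norm

theorem pos_of_mem_ball (hω : IsDiskWeight ω) {w : ℂ} (hw : w ∈ ball (0 : ℂ) 1) :
    0 < ω (1 - ‖w‖) := by
  rw [mem_ball_zero_iff] at hw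
  exact hω.pos _ ⟨by linarith, by linarith [norm_nonneg w]⟩

theorem pos_of_mem_Ioo (hω : IsDiskWeight ω) {r : ℝ} (hr : r ∈ Ioo (0 : ℝ) 1) : 0 < ω (1 - r) :=
  hω.pos _ ⟨by linarith [hr.2], by linarith [hr.1]⟩

theorem aemeasurable_density (hω : IsDiskWeight ω) :
    AEMeasurable (fun w : ℂ => ENNReal.ofReal (ω (1 - ‖w‖))) (volume.restrict (ball 0 1)) :=
  (aemeasurable_comp_norm hω.aemeasurable).ennreal_ofReal

theorem isFiniteMeasure (hω : IsDiskWeight ω) : IsFiniteMeasure (diskMeasure ω) := by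
  refine isFiniteMeasure_withDensity ?_
  rw [lintegral_ball_eq_polar hω.aemeasurable_density]
  have : ∫⁻ r, ∫⁻ θ, ENNReal.ofReal (ω (1 - ‖circleMap 0 r θ‖)) ∂angleMeasure ∂radialMeasure =
      ∫⁻ r, ENNReal.ofReal (ω (1 - r)) * angleMeasure univ ∂radialMeasure := by
    refine lintegral_congr_ae ?_
    filter_upwards [ae_radialMeasure] with r hr
    simp [abs_of_pos hr.1]
  rw [this, lintegral_mul_const' _ _ (measure_ne_top _ _)]
  exact (ENNReal.mul_lt_top hω.integrable.lintegral_lt_top (measure_lt_top _ _)).ne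

theorem integrable_diskMeasure_iff (hω : IsDiskWeight ω) {f : ℂ → ℂ} :
    Integrable f (diskMeasure ω) ↔
      IntegrableOn (fun w => ω (1 - ‖w‖) • f w) (ball 0 1) := by
  rw [diskMeasure, integrable_withDensity_iff_integrable_smul₀' hω.aemeasurable_density (by simp)]
  refine integrable_congr ?_
  filter_upwards [ae_restrict_mem measurableSet_ball] with w hw
  rw [ENNReal.toReal_ofReal (hω.pos_of_mem_ball hw).le]

theorem integral_diskMeasure (hω : IsDiskWeight ω) (f : ℂ → ℂ) :
    ∫ w, f w ∂(diskMeasure ω) = ∫ w in ball 0 1, ω (1 - ‖w‖) • f w := by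
  rw [diskMeasure, integral_withDensity_eq_integral_toReal_smul₀ hω.aemeasurable_density (by simp)]
  refine setIntegral_congr_fun measurableSet_ball fun w hw => ?_
  simp only [ENNReal.toReal_ofReal (hω.pos_of_mem_ball hw).le]

theorem lintegral_diskMeasure (hω : IsDiskWeight ω) (f : ℂ → ENNReal) :
    ∫⁻ w, f w ∂(diskMeasure ω) = ∫⁻ w in ball 0 1, ENNReal.ofReal (ω (1 - ‖w‖)) * f w := by
  rw [diskMeasure, lintegral_withDensity_eq_lintegral_mul_non_measurable₀ _
    hω.aemeasurable_density (by simp)]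
  rfl

theorem ae_diskMeasure : ∀ᵐ w ∂(diskMeasure ω), w ∈ ball (0 : ℂ) 1 :=
  (withDensity_absolutelyContinuous _ _).ae_le (ae_restrict_mem measurableSet_ball)

theorem integral_radialMeasure (f : ℝ → ℝ) :
    ∫ r, f r ∂radialMeasure = ∫ r in Ioo 0 1, r * f r := by
  rw [radialMeasure, integral_withDensity_eq_integral_toReal_smul (by fun_prop) (by simp)]
  refine setIntegral_congr_fun measurableSet_Ioo fun r hr => ?_
  simp only [ENNReal.toReal_ofReal hr.1.le, smul_eq_mul]

theorem moment_eq (ω : ℝ → ℝ) (k : ℕ) :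
    moment ω k = 2 * ∫ r, r ^ (2 * k) * ω (1 - r) ∂radialMeasure := by
  rw [moment, intervalIntegral.integral_of_le zero_le_one, integral_Ioc_eq_integral_Ioo,
    integral_radialMeasure]
  congr 2 with r
  ring

theorem integrable_pow_mul (hω : IsDiskWeight ω) (k : ℕ) :
    Integrable (fun r => r ^ k * ω (1 - r)) radialMeasure := by
  refine hω.integrable.bdd_mul (c := 1) (by fun_prop) ?_
  filter_upwards [ae_radialMeasure] with r hr
  rw [norm_pow, Real.norm_of_nonneg hr.1.le]
  exact pow_le_one₀ hr.1.le hr.2.le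

theorem radialMeasure_Ioo_pos {s : ℝ} (hs : s ∈ Ico (0 : ℝ) 1) : 0 < radialMeasure (Ioo s 1) := by
  rw [pos_iff_ne_zero]
  intro h0
  rw [radialMeasure, withDensity_apply _ measurableSet_Ioo, Measure.restrict_restrict
    measurableSet_Ioo, inter_eq_left.2 (Ioo_subset_Ioo_left hs.1),
    setLIntegral_eq_zero_iff measurableSet_Ioo (by fun_prop)] at h0
  have h1 : volume (Ioo s 1) = 0 := by
    refine measure_mono_null (fun r hr => ?_) h0
    simp only [mem_compl_iff, mem_ofPred_eq, Classical.not_imp]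
    exact ⟨hr, by simpa using hs.1.trans_lt hr.1⟩
  rw [Real.volume_Ioo, ENNReal.ofReal_eq_zero] at h1
  linarith [hs.2]

/-- The moments decay slower than any geometric sequence with ratio less than `1`. -/
theorem exists_le_moment (hω : IsDiskWeight ω) {s : ℝ} (hs : s ∈ Ico (0 : ℝ) 1) :
    ∃ c > 0, ∀ k, c * s ^ (2 * k) ≤ moment ω k := by
  refine ⟨2 * ∫ r in Ioo s 1, ω (1 - r) ∂radialMeasure, ?_, fun k => ?_⟩
  · refine mul_pos two_pos ?_
    rw [setIntegral_pos_iff_support_of_nonneg_ae]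
    · refine (radialMeasure_Ioo_pos hs).trans_le (measure_mono fun r hr => ⟨?_, hr⟩)
      exact (hω.pos_of_mem_Ioo ⟨hs.1.trans_lt hr.1, hr.2⟩).ne'
    · refine (ae_restrict_iff' measurableSet_Ioo).2 (Eventually.of_forall fun r hr => ?_)
      exact (hω.pos_of_mem_Ioo ⟨hs.1.trans_lt hr.1, hr.2⟩).le
    · exact hω.integrable.integrableOn
  · rw [moment_eq, mul_assoc, mul_comm (∫ r in Ioo s 1, ω (1 - r) ∂radialMeasure),
      ← integral_const_mul]
    refine mul_le_mul_of_nonneg_left ?_ two_pos.le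
    refine (setIntegral_mono_on (hω.integrable.integrableOn.const_mul _)
      (hω.integrable_pow_mul (2 * k)).integrableOn measurableSet_Ioo fun r hr => ?_).trans
      (setIntegral_le_integral (hω.integrable_pow_mul _) ?_)
    · exact mul_le_mul_of_nonneg_right (pow_le_pow_left₀ hs.1 hr.1.le _)
        (hω.pos_of_mem_Ioo ⟨hs.1.trans_lt hr.1, hr.2⟩).le
    · filter_upwards [ae_radialMeasure] with r hr
      exact mul_nonneg (pow_nonneg hr.1.le _) (hω.pos_of_mem_Ioo hr).le

theorem moment_pos (hω : IsDiskWeight ω) (k : ℕ) : 0 < moment ω k := by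
  obtain ⟨c, hc, h⟩ := hω.exists_le_moment (s := 1 / 2) ⟨by norm_num, by norm_num⟩
  exact lt_of_lt_of_le (by positivity) (h k)

/-- Integrating against `w̄^k` picks out the Taylor coefficient of index `k`. -/
theorem integral_mul_conj_pow (hω : IsDiskWeight ω) {F : ℂ → ℂ}
    (hF : DifferentiableOn ℂ F (ball 0 1)) (hFi : Integrable F (diskMeasure ω)) (k : ℕ) :
    ∫ w, F w * conj w ^ k ∂(diskMeasure ω) = Real.pi * moment ω k * taylorCoeff F k := by
  have hint : Integrable (fun w => F w * conj w ^ k) (diskMeasure ω) := by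
    refine hFi.mul_bdd (c := 1) (by
      exact (Continuous.aestronglyMeasurable (by fun_prop))) ?_
    filter_upwards [ae_diskMeasure] with w hw
    rw [mem_ball_zero_iff] at hw
    rw [norm_pow, RCLike.norm_conj]
    exact pow_le_one₀ (norm_nonneg w) hw.le
  rw [hω.integral_diskMeasure, integral_ball_eq_polar (hω.integrable_diskMeasure_iff.1 hint)]
  have : ∫ r, ∫ θ, ω (1 - ‖circleMap 0 r θ‖) • (F (circleMap 0 r θ) *
      conj (circleMap 0 r θ) ^ k) ∂angleMeasure ∂radialMeasure =
      ∫ r, ((r ^ (2 * k) * ω (1 - r) : ℝ) : ℂ) * (2 * Real.pi * taylorCoeff F k)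
        ∂radialMeasure := by
    refine integral_congr_ae ?_
    filter_upwards [ae_radialMeasure] with r hr
    have hn : ∀ θ, ‖circleMap 0 r θ‖ = r := fun θ => by
      rw [norm_circleMap_zero, abs_of_pos hr.1]
    simp_rw [hn]
    rw [integral_smul, integral_circleMap_mul_conj_pow hF hr, real_smul]
    push_cast
    ring
  rw [this, integral_mul_const, integral_complex_ofReal, moment_eq]
  push_cast
  ring

end IsDiskWeight

/-! ### The Hilbert space of the weighted measure -/

/-- Bounded sequences in a Hilbert space have weak limits along an ultrafilter. -/
theorem exists_ultrafilter_weak_limit {E : Type*} [NormedAddCommGroup E] [InnerProductSpace ℂ E]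
    [CompleteSpace E] {u : ℕ → E} {R : ℝ} (hu : ∀ n, ‖u n‖ ≤ R) :
    ∃ (U : Ultrafilter ℕ) (x : E), (U : Filter ℕ) ≤ atTop ∧
      ∀ y, Tendsto (fun n => inner ℂ (u n) y) U (𝓝 (inner ℂ x y)) := by
  set f : ℕ → WeakDual ℂ E := fun n => StrongDual.toWeakDual (InnerProductSpace.toDual ℂ E (u n))
    with hf
  have hc := WeakDual.isCompact_closedBall (𝕜 := ℂ) (E := E) 0 R
  have hmem : ∀ n, f n ∈ WeakDual.toStrongDual ⁻¹' closedBall (0 : StrongDual ℂ E) R := by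
    intro n
    rw [mem_preimage, mem_closedBall_zero_iff]
    exact ((InnerProductSpace.toDual ℂ E).norm_map (u n)).trans_le (hu n)
  obtain ⟨L, -, hL⟩ := hc.ultrafilter_le_nhds ((hyperfilter ℕ).map f) (by
    rw [Ultrafilter.coe_map, le_principal_iff]
    exact mem_map.2 (Eventually.of_forall hmem))
  refine ⟨hyperfilter ℕ, (InnerProductSpace.toDual ℂ E).symm (WeakDual.toStrongDual L),
    Nat.hyperfilter_le_atTop, fun y => ?_⟩
  rw [InnerProductSpace.toDual_symm_apply]
  exact ((WeakDual.eval_continuous y).tendsto L).comp hL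

namespace IsDiskWeight

variable {ω : ℝ → ℝ}

/-- The norm of `w ^ k` in `L²` of the weighted measure. -/
noncomputable def monomialNorm (ω : ℝ → ℝ) (k : ℕ) : ℝ := √(Real.pi * moment ω k)

theorem monomialNorm_pos (hω : IsDiskWeight ω) (k : ℕ) : 0 < monomialNorm ω k :=
  Real.sqrt_pos.2 (mul_pos Real.pi_pos (hω.moment_pos k))

theorem monomialNorm_sq (hω : IsDiskWeight ω) (k : ℕ) :
    monomialNorm ω k ^ 2 = Real.pi * moment ω k :=
  Real.sq_sqrt (mul_pos Real.pi_pos (hω.moment_pos k)).le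

theorem memLp_pow (hω : IsDiskWeight ω) (k : ℕ) :
    MemLp (fun w : ℂ => w ^ k) 2 (diskMeasure ω) := by
  have := hω.isFiniteMeasure
  refine MemLp.of_bound (by fun_prop) 1 ?_
  filter_upwards [ae_diskMeasure] with w hw
  rw [mem_ball_zero_iff] at hw
  rw [norm_pow]
  exact pow_le_one₀ (norm_nonneg w) hw.le

theorem memLp_monomial (hω : IsDiskWeight ω) (k : ℕ) :
    MemLp (fun w : ℂ => ((monomialNorm ω k)⁻¹ : ℂ) * w ^ k) 2 (diskMeasure ω) :=
  (hω.memLp_pow k).const_mul _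

/-- The normalized monomials `w ^ k / ‖w ^ k‖`. -/
noncomputable def monomialLp (hω : IsDiskWeight ω) (k : ℕ) : Lp ℂ 2 (diskMeasure ω) :=
  (hω.memLp_monomial k).toLp

theorem inner_toLp {f g : ℂ → ℂ} (hf : MemLp f 2 (diskMeasure ω)) (hg : MemLp g 2 (diskMeasure ω)) :
    inner ℂ (hf.toLp) (hg.toLp) = ∫ w, g w * conj (f w) ∂(diskMeasure ω) := by
  rw [L2.inner_def]
  refine integral_congr_ae ?_
  filter_upwards [hf.coeFn_toLp, hg.coeFn_toLp] with w h1 h2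
  rw [h1, h2, RCLike.inner_apply]

theorem inner_monomialLp (hω : IsDiskWeight ω) (k : ℕ) {f : ℂ → ℂ}
    (hf : MemLp f 2 (diskMeasure ω)) :
    inner ℂ (hω.monomialLp k) (hf.toLp) =
      (monomialNorm ω k : ℂ)⁻¹ * ∫ w, f w * conj w ^ k ∂(diskMeasure ω) := by
  rw [monomialLp, inner_toLp, ← integral_const_mul]
  refine integral_congr_ae (Eventually.of_forall fun w => ?_)
  simp only [map_mul, map_pow, map_inv₀, conj_ofReal]
  ring

theorem inner_monomialLp_of_differentiableOn (hω : IsDiskWeight ω) (k : ℕ) {F : ℂ → ℂ}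
    (hF : DifferentiableOn ℂ F (ball 0 1)) (hFm : MemLp F 2 (diskMeasure ω)) :
    inner ℂ (hω.monomialLp k) (hFm.toLp) = monomialNorm ω k * taylorCoeff F k := by
  have := hω.isFiniteMeasure
  rw [inner_monomialLp, hω.integral_mul_conj_pow hF (hFm.integrable one_le_two), ← mul_assoc]
  congr 1
  have h1 : ((monomialNorm ω k : ℝ) : ℂ) ≠ 0 := by exact_mod_cast (hω.monomialNorm_pos k).ne'
  have h2 : ((monomialNorm ω k : ℝ) : ℂ) ^ 2 = Real.pi * moment ω k := by
    exact_mod_cast hω.monomialNorm_sq k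
  rw [← h2]
  field_simp

theorem orthonormal_monomialLp (hω : IsDiskWeight ω) : Orthonormal ℂ hω.monomialLp := by
  rw [orthonormal_iff_ite]
  intro i j
  have hd : DifferentiableOn ℂ (fun w : ℂ => w ^ j) (ball 0 1) := by fun_prop
  have e : hω.monomialLp j = ((monomialNorm ω j)⁻¹ : ℂ) • (hω.memLp_pow j).toLp := by
    rw [monomialLp, ← MemLp.toLp_const_smul]
    rfl
  rw [e, inner_smul_right, hω.inner_monomialLp_of_differentiableOn i hd, taylorCoeff_pow]
  have h1 : ((monomialNorm ω j : ℝ) : ℂ) ≠ 0 := by exact_mod_cast (hω.monomialNorm_pos j).ne'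
  by_cases h : i = j
  · subst h
    simp [h1]
  · simp [h, Ne.symm h]

theorem ofReal_norm_toLp_sq {f : ℂ → ℂ} (hf : MemLp f 2 (diskMeasure ω)) :
    ENNReal.ofReal (‖hf.toLp‖ ^ 2) = ∫⁻ w, ENNReal.ofReal (‖f w‖ ^ 2) ∂(diskMeasure ω) := by
  rw [Lp.norm_toLp, ENNReal.ofReal_pow ENNReal.toReal_nonneg, ENNReal.ofReal_toReal hf.2.ne]
  have := eLpNorm_nnreal_pow_eq_lintegral (f := f) (μ := diskMeasure ω) (p := 2) two_ne_zero
  simp only [NNReal.coe_ofNat, ENNReal.rpow_ofNat, ENNReal.coe_ofNat] at this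
  rw [this]
  refine lintegral_congr fun w => ?_
  rw [ENNReal.ofReal_pow (norm_nonneg _), ofReal_norm]

/-- Bessel's inequality for the monomials. -/
theorem tsum_integral_mul_conj_pow_le (hω : IsDiskWeight ω) {f : ℂ → ℂ}
    (hf : MemLp f 2 (diskMeasure ω)) :
    ∑' k, ENNReal.ofReal (‖∫ w, f w * conj w ^ k ∂(diskMeasure ω)‖ ^ 2 /
      (Real.pi * moment ω k)) ≤ ∫⁻ w, ENNReal.ofReal (‖f w‖ ^ 2) ∂(diskMeasure ω) := by
  rw [← ofReal_norm_toLp_sq hf]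
  have hs := hω.orthonormal_monomialLp.inner_products_summable (x := hf.toLp)
  have hle := hω.orthonormal_monomialLp.tsum_inner_products_le (x := hf.toLp)
  have e : ∀ k, ‖∫ w, f w * conj w ^ k ∂(diskMeasure ω)‖ ^ 2 / (Real.pi * moment ω k) =
      ‖inner ℂ (hω.monomialLp k) hf.toLp‖ ^ 2 := by
    intro k
    rw [inner_monomialLp, norm_mul, norm_inv, norm_real, Real.norm_of_nonneg
      (hω.monomialNorm_pos k).le, mul_pow, inv_pow, hω.monomialNorm_sq, div_eq_inv_mul]
  simp_rw [e]
  rw [← ENNReal.ofReal_tsum_of_nonneg (fun _ => by positivity) hs]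
  exact ENNReal.ofReal_le_ofReal hle

theorem exists_lp_coeff (hω : IsDiskWeight ω) {F : ℂ → ℂ} (hF : DifferentiableOn ℂ F (ball 0 1))
    (hFm : MemLp F 2 (diskMeasure ω)) :
    ∃ y : lp (fun _ : ℕ => ℂ) 2, ∀ k, y k = monomialNorm ω k * taylorCoeff F k := by
  have hs := hω.orthonormal_monomialLp.inner_products_summable (x := hFm.toLp)
  refine ⟨⟨fun k => monomialNorm ω k * taylorCoeff F k, ?_⟩, fun k => rfl⟩
  refine memℓp_gen ?_
  simpa [hω.inner_monomialLp_of_differentiableOn _ hF hFm] using hs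

/-- The coefficients of the power series attached to a square summable sequence grow slower than
any geometric sequence with ratio greater than `1`. -/
theorem exists_coeff_bound (hω : IsDiskWeight ω) (d : lp (fun _ : ℕ => ℂ) 2) {s : ℝ}
    (hs : s ∈ Ioo (0 : ℝ) 1) : ∃ C, ∀ k, ‖d k * (monomialNorm ω k : ℂ)⁻¹‖ * s ^ k ≤ C := by
  obtain ⟨c, hc, hle⟩ := hω.exists_le_moment (s := s) ⟨hs.1.le, hs.2⟩
  refine ⟨‖d‖ * (√(Real.pi * c))⁻¹, fun k => ?_⟩
  have h1 : √(Real.pi * c) * s ^ k ≤ monomialNorm ω k := by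
    rw [monomialNorm]
    refine Real.le_sqrt_of_sq_le ?_
    rw [mul_pow, Real.sq_sqrt (by positivity), ← pow_mul, mul_comm k 2, mul_assoc]
    exact mul_le_mul_of_nonneg_left (hle k) Real.pi_pos.le
  have h2 : 0 < √(Real.pi * c) := Real.sqrt_pos.2 (mul_pos Real.pi_pos hc)
  have h3 := hω.monomialNorm_pos k
  rw [norm_mul, norm_inv, norm_real, Real.norm_of_nonneg h3.le, mul_assoc]
  refine mul_le_mul (lp.norm_apply_le_norm (by norm_num) d k) ?_
    (by have := hs.1; positivity) (norm_nonneg _)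
  rw [inv_mul_le_iff₀ h3, ← div_eq_mul_inv, le_div_iff₀ h2, mul_comm]
  exact h1

/-- **Synthesis.** A square summable sequence of coefficients with respect to the normalized
monomials is the coefficient sequence of an analytic function: the `L²` sum agrees almost
everywhere with the sum of the power series, which converges in the whole disk. -/
theorem exists_analytic_of_lp (hω : IsDiskWeight ω) (d : lp (fun _ : ℕ => ℂ) 2) :
    ∃ h : ℂ → ℂ, DifferentiableOn ℂ h (ball 0 1) ∧ MemLp h 2 (diskMeasure ω) ∧
      ∀ F : ℂ → ℂ, DifferentiableOn ℂ F (ball 0 1) → MemLp F 2 (diskMeasure ω) →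
        ∀ y : lp (fun _ : ℕ => ℂ) 2, (∀ k, y k = monomialNorm ω k * taylorCoeff F k) →
          ∫ w, F w * conj (h w) ∂(diskMeasure ω) = inner ℂ d y := by
  set T : ℕ → ℂ → ℂ := fun k w => d k * (monomialNorm ω k : ℂ)⁻¹ * w ^ k with hT
  set h : ℂ → ℂ := fun w => ∑' k, T k w with hh
  have hbound : ∀ w₀ ∈ ball (0 : ℂ) 1, ∃ (t : ℝ) (u : ℕ → ℝ), ‖w₀‖ < t ∧ t < 1 ∧ Summable u ∧
      ∀ k, ∀ w ∈ ball (0 : ℂ) t, ‖T k w‖ ≤ u k := by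
    intro w₀ hw₀
    rw [mem_ball_zero_iff] at hw₀
    obtain ⟨t, ht, ht1⟩ := exists_between hw₀
    obtain ⟨s, hts, hs1⟩ := exists_between ht1
    have ht0 : 0 < t := (norm_nonneg _).trans_lt ht
    have hs0 : 0 < s := ht0.trans hts
    obtain ⟨C, hC⟩ := hω.exists_coeff_bound d ⟨hs0, hs1⟩
    refine ⟨t, fun k => C * (t / s) ^ k, ht, ht1, (summable_geometric_of_lt_one (by positivity)
      ((div_lt_one hs0).2 hts)).mul_left _, fun k w hw => ?_⟩
    rw [mem_ball_zero_iff] at hw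
    calc ‖T k w‖ = ‖d k * (monomialNorm ω k : ℂ)⁻¹‖ * ‖w‖ ^ k := by rw [hT]; simp
      _ ≤ ‖d k * (monomialNorm ω k : ℂ)⁻¹‖ * t ^ k := by gcongr
      _ = ‖d k * (monomialNorm ω k : ℂ)⁻¹‖ * s ^ k * (t / s) ^ k := by
          rw [div_pow]; field_simp
      _ ≤ C * (t / s) ^ k := by gcongr; exact hC k
  have hTd : ∀ k (S : Set ℂ), DifferentiableOn ℂ (T k) S := fun k S => by
    simp only [hT]; fun_prop
  have hhd : DifferentiableOn ℂ h (ball 0 1) := by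
    intro w₀ hw₀
    obtain ⟨t, u, ht, -, hu, hle⟩ := hbound w₀ hw₀
    have := differentiableOn_tsum_of_summable_norm hu (fun k => hTd k (ball 0 t)) isOpen_ball hle
    exact (this.differentiableAt (isOpen_ball.mem_nhds
      (mem_ball_zero_iff.2 ht))).differentiableWithinAt
  have hhs : ∀ w ∈ ball (0 : ℂ) 1, HasSum (fun k => T k w) (h w) := by
    intro w hw
    obtain ⟨t, u, ht, -, hu, hle⟩ := hbound w hw
    exact (Summable.of_norm_bounded hu fun k => hle k w (mem_ball_zero_iff.2 ht)).hasSum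
  -- The same series summed in `L²`; a subsequence of its partial sums converges almost everywhere,
  -- which identifies its sum with `h`.
  have hV := hω.orthonormal_monomialLp.orthogonalFamily
  set H : Lp ℂ 2 (diskMeasure ω) := hV.linearIsometry d with hH
  have hsum : HasSum (fun k => d k • hω.monomialLp k) H := by
    simpa using hV.hasSum_linearIsometry d
  have hcoe : ∀ N : ℕ, (∑ k ∈ Finset.range N, d k • hω.monomialLp k : Lp ℂ 2 (diskMeasure ω))
      =ᵐ[diskMeasure ω] fun w => ∑ k ∈ Finset.range N, T k w := by
    intro N
    have h1 : ∀ᵐ w ∂(diskMeasure ω), ∀ k : ℕ,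
        (d k • hω.monomialLp k : Lp ℂ 2 (diskMeasure ω)) w = T k w := by
      refine ae_all_iff.2 fun k => ?_
      filter_upwards [Lp.coeFn_smul (d k) (hω.monomialLp k),
        (hω.memLp_monomial k).coeFn_toLp] with w h1 h2
      rw [h1, Pi.smul_apply, monomialLp, h2, smul_eq_mul, hT]
      ring
    induction N with
    | zero =>
      filter_upwards [Lp.coeFn_zero ℂ 2 (diskMeasure ω)] with w hw
      simpa using hw
    | succ N ih =>
      simp_rw [Finset.sum_range_succ]
      filter_upwards [Lp.coeFn_add (∑ k ∈ Finset.range N, d k • hω.monomialLp k)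
        (d N • hω.monomialLp N), ih, h1] with w h2 h3 h4
      rw [h2, Pi.add_apply, h3, h4 N]
  have hae : (H : ℂ → ℂ) =ᵐ[diskMeasure ω] h := by
    obtain ⟨ns, hns, hlim⟩ :=
      (tendstoInMeasure_of_tendsto_Lp hsum.tendsto_sum_nat).exists_seq_tendsto_ae
    filter_upwards [hlim, ae_all_iff.2 hcoe, ae_diskMeasure] with w h1 h2 h3
    simp_rw [h2] at h1
    exact tendsto_nhds_unique h1 ((hhs w h3).tendsto_sum_nat.comp hns.tendsto_atTop)
  have hhm : MemLp h 2 (diskMeasure ω) := (Lp.memLp H).ae_eq hae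
  refine ⟨h, hhd, hhm, fun F hF hFm y hy => ?_⟩
  have e1 : hhm.toLp = H := by
    refine Lp.ext ?_
    exact hhm.coeFn_toLp.trans hae.symm
  rw [← inner_toLp hhm hFm, e1, ← inner_conj_symm, ← inner_conj_symm d y]
  congr 1
  have h1 := hsum.mapL (innerSL ℂ hFm.toLp)
  have h2 := lp.hasSum_inner (𝕜 := ℂ) y d
  refine h1.unique (h2.congr_fun fun k => ?_)
  rw [innerSL_apply_apply, inner_smul_right, ← inner_conj_symm,
    hω.inner_monomialLp_of_differentiableOn k hF hFm, hy, RCLike.inner_apply]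

end IsDiskWeight

/-! ### Transfer to the disk -/

/-- For analytic functions the measurability part of `MemLp` is automatic. -/
theorem memLp_two_iff_lintegral_lt_top {ω : ℝ → ℝ} {F : ℂ → ℂ}
    (hF : DifferentiableOn ℂ F (ball 0 1)) :
    MemLp F 2 (diskMeasure ω) ↔ ∫⁻ w, ENNReal.ofReal (‖F w‖ ^ 2) ∂(diskMeasure ω) < ⊤ := by
  have hm : AEStronglyMeasurable F (diskMeasure ω) :=
    (hF.continuousOn.aestronglyMeasurable measurableSet_ball).mono_ac
      (withDensity_absolutelyContinuous _ _)
  rw [MemLp, and_iff_right hm, eLpNorm_lt_top_iff_lintegral_rpow_enorm_lt_top two_ne_zero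
    (by simp)]
  simp only [ENNReal.toReal_ofNat, ENNReal.rpow_ofNat]
  rw [lintegral_congr fun w => ?_]
  rw [ENNReal.ofReal_pow (norm_nonneg _), ofReal_norm]

theorem IsDiskWeight.setIntegral_diskMeasure {ω : ℝ → ℝ} (hω : IsDiskWeight ω) {S : Set ℂ}
    (hS : S ⊆ ball 0 1) (hSm : MeasurableSet S) (f : ℂ → ℂ) :
    ∫ w in S, f w ∂(diskMeasure ω) = ∫ w in S, ω (1 - ‖w‖) • f w := by
  rw [← integral_indicator hSm, hω.integral_diskMeasure, ← inter_eq_self_of_subset_right hS,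
    ← setIntegral_indicator hSm, inter_eq_self_of_subset_right hS]
  congr 1 with w
  by_cases hw : w ∈ S <;> simp [hw]

namespace IsConformalPair

variable {φ ψ : ℂ → ℂ} {G : Set ℂ} {ω : ℝ → ℝ}

/-- The mean value property of `(φ')²` bounds the circle means of `|φ'|²` from below. -/
theorem two_pi_mul_le_lintegral (h : IsConformalPair φ ψ G) {r : ℝ} (hr : r ∈ Ioo (0 : ℝ) 1) :
    ENNReal.ofReal (2 * Real.pi * ‖deriv φ 0‖ ^ 2) ≤
      ∫⁻ θ, ENNReal.ofReal (‖deriv φ (circleMap 0 r θ)‖ ^ 2) ∂angleMeasure := by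
  have hd : DifferentiableOn ℂ (fun w => deriv φ w ^ 2) (ball 0 1) := h.differentiableOn_deriv.pow 2
  have h1 := integral_circleMap_mul_conj_pow hd hr 0
  have h2 : taylorCoeff (fun w => deriv φ w ^ 2) 0 = deriv φ 0 ^ 2 := by
    have h3 := hasSum_taylorCoeff hd (w := 0) (by simp)
    have h4 := hasSum_single (f := fun k => taylorCoeff (fun w => deriv φ w ^ 2) k * (0 : ℂ) ^ k) 0
      (fun k hk => by simp [hk])
    simpa using h4.unique h3
  simp only [pow_zero, mul_one, mul_zero, h2] at h1
  have h5 := enorm_integral_le_lintegral_enorm (μ := angleMeasure)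
    (fun θ => deriv φ (circleMap 0 r θ) ^ 2)
  rw [h1] at h5
  refine le_of_eq_of_le ?_ (h5.trans_eq (lintegral_congr fun θ => ?_))
  · rw [← ofReal_norm]
    congr 1
    simp [abs_of_pos Real.pi_pos]
  · rw [← ofReal_norm, norm_pow]

/-- A weight that is integrable on `G` gives a finite measure on the disk, because the means of
`|φ'|²` over circles are at least `|φ'(0)|² > 0`. -/
theorem isDiskWeight (h : IsConformalPair φ ψ G)
    (hωm : AEMeasurable ω (volume.restrict (Ioc 0 1))) (hωpos : ∀ t ∈ Ioc (0 : ℝ) 1, 0 < ω t)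
    (hωint : IntegrableOn (fun z => ω (1 - ‖ψ z‖)) G) : IsDiskWeight ω := by
  refine ⟨hωm, hωpos, ?_⟩
  have hm : AEMeasurable (fun r => ω (1 - r)) radialMeasure :=
    hωm.comp_quasiMeasurePreserving quasiMeasurePreserving_one_sub
  refine ⟨hm.aestronglyMeasurable, ?_⟩
  rw [hasFiniteIntegral_iff_ofReal]
  swap
  · filter_upwards [ae_radialMeasure] with r hr
    exact (hωpos _ ⟨by linarith [hr.2], by linarith [hr.1]⟩).le
  rw [← h.image_ball, h.integrableOn_image (subset_refl _) measurableSet_ball] at hωint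
  have h1 := hωint.lintegral_lt_top
  have h2 : ∫⁻ w in ball 0 1, ENNReal.ofReal (‖deriv φ w‖ ^ 2 • ω (1 - ‖ψ (φ w)‖)) =
      ∫⁻ w in ball 0 1, ENNReal.ofReal (‖deriv φ w‖ ^ 2) * ENNReal.ofReal (ω (1 - ‖w‖)) := by
    refine setLIntegral_congr_fun measurableSet_ball fun w hw => ?_
    rw [h.symm_apply hw, smul_eq_mul, ENNReal.ofReal_mul (by positivity)]
  have hmd : Measurable fun w => ENNReal.ofReal (‖deriv φ w‖ ^ 2) :=
    ((measurable_deriv φ).norm.pow_const 2).ennreal_ofReal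
  rw [h2, lintegral_ball_eq_polar
    (f := fun w => ENNReal.ofReal (‖deriv φ w‖ ^ 2) * ENNReal.ofReal (ω (1 - ‖w‖)))
    (hmd.aemeasurable.mul (IsDiskWeight.aemeasurable_comp_norm hωm).ennreal_ofReal)] at h1
  have h3 : ∫⁻ r, ENNReal.ofReal (2 * Real.pi * ‖deriv φ 0‖ ^ 2) * ENNReal.ofReal (ω (1 - r))
      ∂radialMeasure < ⊤ := by
    refine lt_of_le_of_lt (lintegral_mono_ae ?_) h1
    filter_upwards [ae_radialMeasure] with r hr
    have hn : ∀ θ, ‖circleMap 0 r θ‖ = r := fun θ => by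
      rw [norm_circleMap_zero, abs_of_pos hr.1]
    simp_rw [hn]
    rw [lintegral_mul_const' _ _ (by simp)]
    gcongr
    exact h.two_pi_mul_le_lintegral hr
  rw [lintegral_const_mul' _ _ (by simp)] at h3
  refine ENNReal.lt_top_of_mul_ne_top_right h3.ne ?_
  have h0 := norm_pos_iff.2 (h.deriv_ne_zero (w := 0) (by simp))
  have := Real.pi_pos
  exact (ENNReal.ofReal_pos.2 (by positivity)).ne'

/-- The map `g ↦ (g ∘ φ) φ'` preserves the Bergman norm. -/
theorem lintegral_bergman (h : IsConformalPair φ ψ G) (hω : IsDiskWeight ω) (g : ℂ → ℂ) :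
    ∫⁻ z in G, ENNReal.ofReal (‖g z‖ ^ 2 * ω (1 - ‖ψ z‖)) =
      ∫⁻ w, ENNReal.ofReal (‖g (φ w) * deriv φ w‖ ^ 2) ∂(diskMeasure ω) := by
  rw [hω.lintegral_diskMeasure, ← h.image_ball,
    h.lintegral_image (subset_refl _) measurableSet_ball]
  refine setLIntegral_congr_fun measurableSet_ball fun w hw => ?_
  rw [h.symm_apply hw, ← ENNReal.ofReal_mul (by positivity),
    ← ENNReal.ofReal_mul (hω.pos_of_mem_ball hw).le]
  congr 1
  rw [norm_mul]
  ring

theorem differentiableOn_pullback (h : IsConformalPair φ ψ G) {g : ℂ → ℂ}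
    (hg : DifferentiableOn ℂ g G) :
    DifferentiableOn ℂ (fun w => g (φ w) * deriv φ w) (ball 0 1) :=
  (hg.comp h.differentiableOn h.mapsTo).mul h.differentiableOn_deriv

theorem mem_bergmanSpace_iff (h : IsConformalPair φ ψ G) (hω : IsDiskWeight ω) {g : ℂ → ℂ}
    (hg : DifferentiableOn ℂ g G) :
    g ∈ bergmanSpace G ω ψ ↔ MemLp (fun w => g (φ w) * deriv φ w) 2 (diskMeasure ω) := by
  rw [memLp_two_iff_lintegral_lt_top (h.differentiableOn_pullback hg), ← h.lintegral_bergman hω,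
    bergmanSpace, Set.mem_ofPred_eq, and_iff_right hg, bergmanNorm, ENNReal.rpow_lt_top_iff_of_pos
      (by norm_num)]

theorem memLp_deriv (h : IsConformalPair φ ψ G) (hω : IsDiskWeight ω)
    (hωint : IntegrableOn (fun z => ω (1 - ‖ψ z‖)) G) :
    MemLp (deriv φ) 2 (diskMeasure ω) := by
  rw [memLp_two_iff_lintegral_lt_top h.differentiableOn_deriv]
  have := h.lintegral_bergman hω (fun _ => 1)
  simp only [norm_one, one_pow, one_mul] at this
  rw [← this]
  exact hωint.lintegral_lt_top

/-- The weighted Cauchy integral over a part of `G`, in terms of `(g ∘ φ) φ'`. -/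
theorem integral_image_cauchy (h : IsConformalPair φ ψ G) (hω : IsDiskWeight ω) {S : Set ℂ}
    (hS : S ⊆ ball 0 1) (hSm : MeasurableSet S) (g : ℂ → ℂ) (ζ : ℂ) :
    ∫ z in φ '' S, conj (g z) * ((ω (1 - ‖ψ z‖) : ℝ) : ℂ) / (z - ζ) =
      ∫ w in S, conj (g (φ w) * deriv φ w) * deriv φ w / (φ w - ζ) ∂(diskMeasure ω) := by
  rw [hω.setIntegral_diskMeasure hS hSm, h.integral_image hS hSm]
  refine setIntegral_congr_fun hSm fun w hw => ?_
  have e : ((‖deriv φ w‖ ^ 2 : ℝ) : ℂ) = conj (deriv φ w) * deriv φ w := by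
    rw [← normSq_eq_norm_sq, normSq_eq_conj_mul_self]
  simp only [real_smul]
  rw [h.symm_apply (hS hw), e, map_mul]
  ring

theorem aestronglyMeasurable_diskMeasure (h : IsConformalPair φ ψ G) (ω : ℝ → ℝ) :
    AEStronglyMeasurable φ (diskMeasure ω) :=
  (h.differentiableOn.continuousOn.aestronglyMeasurable measurableSet_ball).mono_ac
    (withDensity_absolutelyContinuous _ _)

theorem cauchyTransform_eq (h : IsConformalPair φ ψ G) (hω : IsDiskWeight ω) (g : ℂ → ℂ) (ζ : ℂ) :
    cauchyTransform G ω ψ g ζ = 1 / Real.pi *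
      ∫ w in ball 0 1, conj (g (φ w) * deriv φ w) * deriv φ w / (φ w - ζ) ∂(diskMeasure ω) := by
  rw [cauchyTransform, ← h.integral_image_cauchy hω (subset_refl _) measurableSet_ball,
    h.image_ball]

theorem exists_dist_lower_bound (h : IsConformalPair φ ψ G) {L : Set ℂ} (hL : IsCompact L)
    (hLG : L ⊆ (closure G)ᶜ) :
    ∃ δ > 0, ∀ ζ ∈ L, ∀ w ∈ ball (0 : ℂ) 1, δ ≤ ‖φ w - ζ‖ := by
  obtain ⟨δ, hδ, hlt⟩ := Metric.exists_pos_forall_lt_edist hL isClosed_closure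
    (disjoint_left.2 fun z hz hz' => hLG hz hz' : Disjoint L (closure G))
  refine ⟨δ, by exact_mod_cast hδ, fun ζ hζ w hw => ?_⟩
  have := hlt ζ hζ (φ w) (subset_closure (h.mapsTo hw))
  rw [edist_comm, edist_eq_enorm_sub, enorm_eq_nnnorm] at this
  exact_mod_cast this.le

/-- The Cauchy kernel with pole outside of `closure G`, transferred to the disk. -/
theorem kernel_properties (h : IsConformalPair φ ψ G)
    (hφ' : MemLp (deriv φ) 2 (diskMeasure ω)) {ζ : ℂ} (hζ : ζ ∈ (closure G)ᶜ) :
    DifferentiableOn ℂ (fun w => deriv φ w / (φ w - ζ)) (ball 0 1) ∧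
      MemLp (fun w => deriv φ w / (φ w - ζ)) 2 (diskMeasure ω) := by
  obtain ⟨δ, hδ, hle⟩ := h.exists_dist_lower_bound isCompact_singleton
    (singleton_subset_iff.2 hζ)
  have hle' := hle ζ rfl
  have hd : DifferentiableOn ℂ (fun w => deriv φ w / (φ w - ζ)) (ball 0 1) := by
    refine h.differentiableOn_deriv.div (h.differentiableOn.sub_const ζ) fun w hw h0 => ?_
    have := hle' w hw
    rw [h0, norm_zero] at this
    linarith
  refine ⟨hd, hφ'.of_le_mul (c := δ⁻¹) ?_ ?_⟩
  · exact (hd.continuousOn.aestronglyMeasurable measurableSet_ball).mono_ac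
      (withDensity_absolutelyContinuous _ _)
  · filter_upwards [IsDiskWeight.ae_diskMeasure] with w hw
    rw [norm_div, div_eq_inv_mul]
    gcongr
    exact hle' w hw

end IsConformalPair

/-! ### Cauchy transforms belong to the closure space -/

/-- The Cauchy integral, up to the factor `π⁻¹`, of the density `k` with respect to the weighted
measure over the disk of radius `s`, transplanted by `φ`. -/
noncomputable def diskCauchy (ω : ℝ → ℝ) (φ k : ℂ → ℂ) (s : ℝ) (ζ : ℂ) : ℂ :=
  1 / Real.pi * ∫ w in ball 0 s, k w / (φ w - ζ) ∂(diskMeasure ω)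

theorem rho_le_of_forall {ω : ℝ → ℝ} {f : ℝ → ℂ} {B : ℝ≥0∞}
    (h : ∑' k : ℕ, ENNReal.ofReal (Real.pi *
      (‖fourierCoeffOn Real.two_pi_pos f (-((k : ℤ) + 1))‖ ^ 2 / moment ω k)) ≤ B) :
    rho ω f ≤ B ^ (1 / 2 : ℝ) := by
  rw [rho]
  refine ENNReal.rpow_le_rpow ?_ (by norm_num)
  rw [← ENNReal.tsum_mul_left]
  simp_rw [← ENNReal.ofReal_mul Real.pi_pos.le]
  exact h

namespace IsConformalPair

variable {φ ψ k : ℂ → ℂ} {G : Set ℂ} {ω : ℝ → ℝ}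

theorem analyticOutside_diskCauchy (h : IsConformalPair φ ψ G) (hk : Integrable k (diskMeasure ω))
    {s : ℝ} (hs : s ≤ 1) : AnalyticOutside (φ '' ball 0 s) (diskCauchy ω φ k s) := by
  have hφ := (h.aestronglyMeasurable_diskMeasure ω).mono_measure
    (Measure.restrict_le_self (s := ball 0 s))
  have hmem : ∀ᵐ w ∂(diskMeasure ω).restrict (ball 0 s), φ w ∈ closure (φ '' ball 0 s) := by
    filter_upwards [ae_restrict_mem measurableSet_ball] with w hw
    exact subset_closure (mem_image_of_mem φ hw)
  have hb : Bornology.IsBounded (closure (φ '' ball 0 s)) := by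
    refine (h.isBounded.subset ?_).closure
    rw [← h.image_ball]
    exact image_mono (ball_subset_ball hs)
  refine ⟨(differentiableOn_integral_div_sub isClosed_closure hk.integrableOn hφ hmem).const_mul _,
    ?_⟩
  have := (tendsto_integral_div_sub hb hk.integrableOn hφ hmem).const_mul (1 / Real.pi : ℂ)
  rw [mul_zero] at this
  exact this

theorem tendstoUniformlyOn_diskCauchy (h : IsConformalPair φ ψ G)
    (hk : Integrable k (diskMeasure ω)) {s : ℕ → ℝ} (hmono : StrictMono s)
    (hs : ∀ n, s n ∈ Ioo (0 : ℝ) 1) (hlim : Tendsto s atTop (𝓝 1)) {L : Set ℂ} (hL : IsCompact L)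
    (hLG : L ⊆ (closure G)ᶜ) :
    TendstoUniformlyOn (fun n => diskCauchy ω φ k (s n)) (diskCauchy ω φ k 1) atTop L := by
  obtain ⟨δ, hδ, hle⟩ := h.exists_dist_lower_bound hL hLG
  have hU : ⋃ n, ball (0 : ℂ) (s n) = ball 0 1 := by
    refine Subset.antisymm (iUnion_subset fun n => ball_subset_ball (hs n).2.le) fun w hw => ?_
    rw [mem_ball_zero_iff] at hw
    obtain ⟨n, hn⟩ := (hlim.eventually (lt_mem_nhds hw)).exists
    exact mem_iUnion.2 ⟨n, mem_ball_zero_iff.2 hn⟩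
  have hT := tendsto_setIntegral_of_monotone (μ := diskMeasure ω) (f := fun w => ‖k w‖)
    (s := fun n => ball (0 : ℂ) (s n)) (fun _ => measurableSet_ball)
    (fun m n hmn => ball_subset_ball (hmono.monotone hmn)) hk.norm.integrableOn
  rw [hU] at hT
  have hT' : Tendsto (fun n => (Real.pi⁻¹ * δ⁻¹) * ((∫ w in ball 0 1, ‖k w‖ ∂(diskMeasure ω)) -
      ∫ w in ball 0 (s n), ‖k w‖ ∂(diskMeasure ω))) atTop (𝓝 0) := by
    have hc := tendsto_const_nhds (f := atTop (α := ℕ))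
      (x := ∫ w in ball 0 1, ‖k w‖ ∂(diskMeasure ω))
    simpa using (hc.sub hT).const_mul (Real.pi⁻¹ * δ⁻¹)
  rw [Metric.tendstoUniformlyOn_iff]
  intro ε hε
  filter_upwards [hT'.eventually (gt_mem_nhds hε)] with n hn ζ hζ
  refine lt_of_le_of_lt ?_ hn
  have hint : ∀ t ≤ 1, IntegrableOn (fun w => k w / (φ w - ζ)) (ball 0 t) (diskMeasure ω) := by
    intro t ht
    have hi : IntegrableOn (fun w => ‖k w‖ * δ⁻¹) (ball 0 t) (diskMeasure ω) :=
      (hk.norm.mul_const _).integrableOn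
    refine hi.mono' ((hk.aestronglyMeasurable.div₀ ((h.aestronglyMeasurable_diskMeasure ω).sub
      aestronglyMeasurable_const)).mono_measure Measure.restrict_le_self) ?_
    filter_upwards [ae_restrict_mem measurableSet_ball] with w hw
    rw [norm_div, div_eq_mul_inv]
    gcongr
    exact hle ζ hζ w (ball_subset_ball ht hw)
  have hsub : ball (0 : ℂ) (s n) ⊆ ball 0 1 := ball_subset_ball (hs n).2.le
  rw [dist_eq_norm, diskCauchy, diskCauchy, ← mul_sub,
    ← setIntegral_sdiff measurableSet_ball (hint 1 le_rfl) hsub,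
    ← setIntegral_sdiff measurableSet_ball hk.norm.integrableOn hsub, norm_mul, mul_assoc]
  have hpi : ‖(1 / Real.pi : ℂ)‖ = Real.pi⁻¹ := by
    rw [one_div, norm_inv, norm_real, Real.norm_of_nonneg Real.pi_pos.le]
  rw [hpi, ← integral_const_mul]
  gcongr
  refine norm_integral_le_of_norm_le (hk.norm.integrableOn.const_mul _) ?_
  filter_upwards [ae_restrict_mem (measurableSet_ball.diff measurableSet_ball)] with w hw
  rw [norm_div, div_eq_inv_mul]
  gcongr
  exact hle ζ hζ w hw.1

/-- The pole of `w ^ j / (φ(v) - φ(w))` at `w = v` has residue `-v ^ j / φ'(v)`. -/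
theorem circleIntegral_pow_div_sub (h : IsConformalPair φ ψ G) {v : ℂ} {r : ℝ}
    (hv : v ∈ ball (0 : ℂ) r) (hr : r < 1) (j : ℕ) :
    ∮ w in C(0, r), w ^ j / (φ v - φ w) = -(2 * Real.pi * I * (v ^ j / deriv φ v)) := by
  have hr0 : 0 < r := pos_of_mem_ball hv
  have hv1 : v ∈ ball (0 : ℂ) 1 := ball_subset_ball hr.le hv
  have hd : DifferentiableOn ℂ (fun w => w ^ j * (dslope φ v w)⁻¹) (closedBall 0 r) :=
    (differentiableOn_id.pow j).mul (((h.differentiableOn_dslope hv1).mono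
      (closedBall_subset_ball hr)).inv fun w hw =>
        h.dslope_ne_zero hv1 (closedBall_subset_ball hr hw))
  have := hd.circleIntegral_sub_inv_smul hv
  rw [dslope_same, smul_eq_mul, ← div_eq_mul_inv] at this
  rw [← this, ← neg_one_mul, ← circleIntegral.integral_const_mul]
  refine circleIntegral.integral_congr hr0.le fun w _ => ?_
  simp only [smul_eq_mul]
  rw [← neg_sub (φ w) (φ v), div_eq_mul_inv, inv_neg, inv_sub_eq_inv_mul_inv_dslope]
  ring

/-- The Fourier coefficients of negative index of the boundary function of a Cauchy integral over a
smaller disk: by Fubini's theorem and the residue theorem they are moments of the density. -/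
theorem fourierCoeffOn_diskCauchy (h : IsConformalPair φ ψ G) (hω : IsDiskWeight ω)
    {f : ℂ → ℂ} (hk : Integrable (fun w => conj (f w) * deriv φ w) (diskMeasure ω)) {s : ℝ}
    (hs : s ∈ Ioo (0 : ℝ) 1) (j : ℕ) :
    fourierCoeffOn Real.two_pi_pos
      (fun θ => diskCauchy ω φ (fun w => conj (f w) * deriv φ w) s (boundaryValue φ θ))
        (-((j : ℤ) + 1)) =
      -(1 / Real.pi) * conj (∫ w in ball 0 s, f w * conj w ^ j ∂(diskMeasure ω)) := by
  set k : ℂ → ℂ := fun w => conj (f w) * deriv φ w with hkdef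
  obtain ⟨r₀, hsr₀, hr₀⟩ := exists_between hs.2
  obtain ⟨r, hrr₀, hr⟩ := exists_between hr₀
  have hr0 : 0 < r := hs.1.trans (hsr₀.trans hrr₀)
  have hfin := hω.isFiniteMeasure
  have hcb : closedBall (0 : ℂ) s ⊆ ball 0 1 := closedBall_subset_ball hs.2
  have hsph : sphere (0 : ℂ) r ⊆ ball 0 1 := sphere_subset_closedBall.trans
    (closedBall_subset_ball hr)
  have hcpt : IsCompact (φ '' closedBall 0 s) :=
    (isCompact_closedBall 0 s).image_of_continuousOn (h.differentiableOn.continuousOn.mono hcb)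
  have hcl : closure (φ '' ball 0 s) ⊆ φ '' closedBall 0 s :=
    closure_minimal (image_mono ball_subset_closedBall) hcpt.isClosed
  rw [h.fourierCoeffOn_comp_boundaryValue (r₀ := r₀) (K := closure (φ '' ball 0 s))
    (hs.1.trans hsr₀).le (hcl.trans (image_mono (closedBall_subset_ball hsr₀))) isClosed_closure
    (h.analyticOutside_diskCauchy hk hs.2.le).1 ⟨hrr₀, hr⟩ j]
  -- distance between the disk of integration and the circle of radius `r`
  have hcpt' : IsCompact (φ '' sphere 0 r) :=
    (isCompact_sphere 0 r).image_of_continuousOn (h.differentiableOn.continuousOn.mono hsph)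
  obtain ⟨δ, hδ, hlt⟩ := Metric.exists_pos_forall_lt_edist hcpt hcpt'.isClosed (by
    rw [disjoint_left]
    rintro _ ⟨v, hv, rfl⟩ ⟨w, hw, hwv⟩
    have := h.injOn (hsph hw) (hcb hv) hwv
    subst this
    rw [mem_closedBall_zero_iff] at hv
    rw [mem_sphere_zero_iff_norm] at hw
    linarith)
  have hdist : ∀ v ∈ ball (0 : ℂ) s, ∀ θ, (δ : ℝ) ≤ ‖φ v - φ (circleMap 0 r θ)‖ := by
    intro v hv θ
    have := hlt _ (mem_image_of_mem φ (ball_subset_closedBall hv)) _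
      (mem_image_of_mem φ (circleMap_mem_sphere 0 hr0.le θ))
    rw [edist_eq_enorm_sub, enorm_eq_nnnorm] at this
    exact_mod_cast this.le
  have hδ' : (0 : ℝ) < δ := by exact_mod_cast hδ
  have hcφ : Continuous fun θ => φ (circleMap 0 r θ) :=
    (h.differentiableOn.continuousOn.mono hsph).comp_continuous (continuous_circleMap 0 r)
      (circleMap_mem_sphere 0 hr0.le)
  set ν := (diskMeasure ω).restrict (ball 0 s) with hν
  have hφm : AEStronglyMeasurable φ ν :=
    (h.aestronglyMeasurable_diskMeasure ω).mono_measure Measure.restrict_le_self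
  have hFub : Integrable (Function.uncurry fun (θ : ℝ) (v : ℂ) => k v *
      (circleMap 0 r θ * I * (circleMap 0 r θ ^ j / (φ v - φ (circleMap 0 r θ)))))
      (angleMeasure.prod ν) := by
    have hk2 : Integrable (fun p : ℝ × ℂ => k p.2) (angleMeasure.prod ν) :=
      (hk.integrableOn (s := ball 0 s)).comp_snd angleMeasure
    refine hk2.mul_bdd (c := r * (r ^ j * (δ : ℝ)⁻¹)) ?_ ?_
    · have hc1 : Continuous fun p : ℝ × ℂ => circleMap 0 r p.1 :=
        (continuous_circleMap 0 r).comp continuous_fst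
      refine ((hc1.mul continuous_const).aestronglyMeasurable).mul
        ((hc1.pow j).aestronglyMeasurable.div₀ (hφm.comp_snd.sub ?_))
      exact (hcφ.comp continuous_fst).aestronglyMeasurable
    · have : ∀ᵐ p : ℝ × ℂ ∂angleMeasure.prod ν, p.2 ∈ ball (0 : ℂ) s :=
        Measure.quasiMeasurePreserving_snd.ae (ae_restrict_mem measurableSet_ball)
      filter_upwards [this] with p hp
      rw [norm_mul, norm_mul, norm_div, norm_pow, norm_circleMap_zero, abs_of_pos hr0, norm_I,
        mul_one, div_eq_mul_inv]
      gcongr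
      exact hdist _ hp _
  have e1 : (∮ w in C(0, r), diskCauchy ω φ k s (φ w) * w ^ j) =
      1 / Real.pi * ∫ v, k v * -(2 * Real.pi * I * (v ^ j / deriv φ v)) ∂ν := by
    have e2 : ∀ v ∈ ball (0 : ℂ) s, k v * -(2 * Real.pi * I * (v ^ j / deriv φ v)) =
        ∫ θ, k v * (circleMap 0 r θ * I * (circleMap 0 r θ ^ j / (φ v - φ (circleMap 0 r θ))))
          ∂angleMeasure := by
      intro v hv
      rw [integral_const_mul, ← h.circleIntegral_pow_div_sub
        (ball_subset_ball (hsr₀.trans hrr₀).le hv) hr, circleIntegral_eq_integral_angleMeasure]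
    rw [setIntegral_congr_fun measurableSet_ball e2, ← integral_integral_swap hFub,
      circleIntegral_eq_integral_angleMeasure, ← integral_const_mul]
    refine integral_congr_ae (Eventually.of_forall fun θ => ?_)
    simp only [diskCauchy]
    rw [mul_assoc (1 / Real.pi : ℂ), ← mul_assoc (circleMap 0 r θ * I),
      mul_comm _ (1 / Real.pi : ℂ), mul_assoc, ← integral_mul_const, ← integral_const_mul]
    congr 1
    refine integral_congr_ae (Eventually.of_forall fun v => ?_)
    simp only
    ring
  rw [e1, ← integral_conj, ← integral_const_mul, ← integral_const_mul, ← integral_const_mul]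
  refine setIntegral_congr_fun measurableSet_ball fun v hv => ?_
  have hne := h.deriv_ne_zero (ball_subset_ball hs.2.le hv)
  have hpi : (Real.pi : ℂ) ≠ 0 := by exact_mod_cast Real.pi_ne_zero
  have hI := I_ne_zero
  simp only [hkdef, map_mul, map_pow, conj_conj]
  field_simp

/-- Bessel's inequality, applied to `f` restricted to the disk of radius `s`, bounds `ρ`. -/
theorem rho_diskCauchy_le (h : IsConformalPair φ ψ G) (hω : IsDiskWeight ω) {f : ℂ → ℂ}
    (hf : MemLp f 2 (diskMeasure ω))
    (hk : Integrable (fun w => conj (f w) * deriv φ w) (diskMeasure ω)) {s : ℝ}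
    (hs : s ∈ Ioo (0 : ℝ) 1) :
    rho ω (fun θ => diskCauchy ω φ (fun w => conj (f w) * deriv φ w) s (boundaryValue φ θ)) ≤
      (∫⁻ w, ENNReal.ofReal (‖f w‖ ^ 2) ∂(diskMeasure ω)) ^ (1 / 2 : ℝ) := by
  refine rho_le_of_forall ?_
  have hfs : MemLp (indicator (ball 0 s) f) 2 (diskMeasure ω) := hf.indicator measurableSet_ball
  have hB := hω.tsum_integral_mul_conj_pow_le hfs
  refine le_of_eq_of_le (tsum_congr fun j => ?_) (hB.trans (lintegral_mono fun w => ?_))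
  · rw [h.fourierCoeffOn_diskCauchy hω hk hs, norm_mul, RCLike.norm_conj]
    have e : ∫ w, indicator (ball 0 s) f w * conj w ^ j ∂(diskMeasure ω) =
        ∫ w in ball 0 s, f w * conj w ^ j ∂(diskMeasure ω) := by
      rw [← integral_indicator measurableSet_ball]
      congr 1 with w
      by_cases hw : w ∈ ball (0 : ℂ) s <;> simp [hw]
    have hpi : ‖(-(1 / Real.pi) : ℂ)‖ = Real.pi⁻¹ := by
      rw [norm_neg, one_div, norm_inv, norm_real, Real.norm_of_nonneg Real.pi_pos.le]
    rw [e, hpi]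
    congr 1
    have := hω.moment_pos j
    have := Real.pi_pos
    field_simp
  · refine ENNReal.ofReal_le_ofReal ?_
    gcongr
    exact norm_indicator_le_norm_self f w

theorem approximatesFromInside_image_ball (h : IsConformalPair φ ψ G) {s : ℕ → ℝ}
    (hmono : StrictMono s) (hs : ∀ n, s n ∈ Ioo (0 : ℝ) 1) (hlim : Tendsto s atTop (𝓝 1)) :
    ApproximatesFromInside (fun n => φ '' ball 0 (s n)) G where
  isOpen n := h.isOpen_image (ball_subset_ball (hs n).2.le) isOpen_ball
  isConnected n := by
    refine ⟨(nonempty_ball.2 (hs n).1).image φ, ?_⟩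
    exact (convex_ball 0 (s n)).isPreconnected.image φ
      (h.differentiableOn.continuousOn.mono (ball_subset_ball (hs n).2.le))
  closure_subset n := by
    have hc : IsCompact (φ '' closedBall 0 (s n)) :=
      (isCompact_closedBall 0 (s n)).image_of_continuousOn
        (h.differentiableOn.continuousOn.mono (closedBall_subset_ball (hs n).2))
    exact (closure_minimal (image_mono ball_subset_closedBall) hc.isClosed).trans
      (image_mono (closedBall_subset_ball (hmono n.lt_succ_self)))
  subset n := by
    rw [← h.image_ball]
    exact image_mono (ball_subset_ball (hs n).2.le)
  iUnion_eq := by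
    rw [← image_iUnion, ← h.image_ball]
    congr 1
    refine Subset.antisymm (iUnion_subset fun n => ball_subset_ball (hs n).2.le) fun w hw => ?_
    rw [mem_ball_zero_iff] at hw
    obtain ⟨n, hn⟩ := (hlim.eventually (lt_mem_nhds hw)).exists
    exact mem_iUnion.2 ⟨n, mem_ball_zero_iff.2 hn⟩

theorem cauchyTransform_mem_spaceWBar (h : IsConformalPair φ ψ G) (hω : IsDiskWeight ω)
    (hφ' : MemLp (deriv φ) 2 (diskMeasure ω)) {g : ℂ → ℂ} (hg : g ∈ bergmanSpace G ω ψ) :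
    cauchyTransform G ω ψ g ∈ spaceWBar G ω φ := by
  set f : ℂ → ℂ := fun w => g (φ w) * deriv φ w with hf
  have hfm : MemLp f 2 (diskMeasure ω) := (h.mem_bergmanSpace_iff hω hg.1).1 hg
  have hk : Integrable (fun w => conj (f w) * deriv φ w) (diskMeasure ω) :=
    hfm.star.integrable_mul hφ'
  have e : cauchyTransform G ω ψ g = diskCauchy ω φ (fun w => conj (f w) * deriv φ w) 1 := by
    ext ζ; exact h.cauchyTransform_eq hω g ζ
  obtain ⟨s, hmono, hs, hlim⟩ := exists_seq_strictMono_tendsto' (zero_lt_one (α := ℝ))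
  have hfin : (∫⁻ w, ENNReal.ofReal (‖f w‖ ^ 2) ∂(diskMeasure ω)) ^ (1 / 2 : ℝ) < ⊤ := by
    refine ENNReal.rpow_lt_top_of_nonneg (by norm_num) ?_
    exact ((memLp_two_iff_lintegral_lt_top (h.differentiableOn_pullback hg.1)).1 hfm).ne
  have hA := h.approximatesFromInside_image_ball hmono hs hlim
  have hO : ∀ n, AnalyticOutside (φ '' ball 0 (s n))
      (diskCauchy ω φ (fun w => conj (f w) * deriv φ w) (s n)) := fun n =>
    h.analyticOutside_diskCauchy hk (hs n).2.le
  rw [e]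
  refine ⟨?_, fun n => φ '' ball 0 (s n), fun n => diskCauchy ω φ _ (s n), hA, hO,
    fun L hL hLG => h.tendstoUniformlyOn_diskCauchy hk hmono hs hlim hL hLG, fun n => ⟨?_, ?_⟩, ?_⟩
  · have := h.analyticOutside_diskCauchy hk le_rfl
    rwa [h.image_ball] at this
  · rw [intervalIntegrable_iff_integrableOn_Ioc_of_le Real.two_pi_pos.le]
    exact h.integrable_comp_boundaryValue (hs (n + 1)).1.le (hs (n + 1)).2 (hA.closure_subset n)
      isClosed_closure (hO n).1
  · exact (h.rho_diskCauchy_le hω hfm hk (hs n)).trans_lt hfin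
  · exact (iSup_le fun n => h.rho_diskCauchy_le hω hfm hk (hs n)).trans_lt hfin

end IsConformalPair

/-! ### Members of the closure space are Cauchy transforms -/

theorem hasSum_taylorCoeff_mul_circleIntegral {A F : ℂ → ℂ} {r : ℝ} (hr : r ∈ Ioo (0 : ℝ) 1)
    (hA : ContinuousOn A (sphere 0 r)) (hF : DifferentiableOn ℂ F (ball 0 1)) :
    HasSum (fun k => taylorCoeff F k * ∮ w in C(0, r), A w * w ^ k)
      (∮ w in C(0, r), A w * F w) := by
  obtain ⟨M, hM⟩ := (isCompact_sphere (0 : ℂ) r).exists_bound_of_continuousOn hA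
  have hmem : ∀ θ, circleMap 0 r θ ∈ sphere (0 : ℂ) r := circleMap_mem_sphere 0 hr.1.le
  have hnorm : ∀ θ, ‖circleMap 0 r θ‖ = r := fun θ => by
    rw [norm_circleMap_zero, abs_of_pos hr.1]
  have hAc : Continuous fun θ => A (circleMap 0 r θ) :=
    hA.comp_continuous (continuous_circleMap 0 r) hmem
  have hball : ∀ θ, circleMap 0 r θ ∈ ball (0 : ℂ) 1 := fun θ => by
    rw [mem_ball_zero_iff, hnorm]; exact hr.2
  have hs : Summable fun k => ‖taylorCoeff F k‖ * r ^ k := by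
    have := (hasSum_taylorCoeff hF (hball 0)).summable.norm
    simpa only [norm_mul, norm_pow, hnorm] using this
  simp_rw [circleIntegral_eq_integral_angleMeasure, ← integral_const_mul]
  refine hasSum_integral_of_dominated_convergence
    (fun k _ => r * M * (‖taylorCoeff F k‖ * r ^ k)) (fun k => ?_) (fun k => ?_) ?_ ?_ ?_
  · have hc := continuous_circleMap 0 r
    exact (continuous_const.mul ((hc.mul continuous_const).mul
      (hAc.mul (hc.pow k)))).aestronglyMeasurable
  · refine Eventually.of_forall fun θ => ?_
    simp only [norm_mul, norm_pow, hnorm, norm_I, mul_one]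
    calc ‖taylorCoeff F k‖ * (r * (‖A (circleMap 0 r θ)‖ * r ^ k))
        = r * ‖A (circleMap 0 r θ)‖ * (‖taylorCoeff F k‖ * r ^ k) := by ring
      _ ≤ r * M * (‖taylorCoeff F k‖ * r ^ k) := by
          have := hr.1
          gcongr
          exact hM _ (hmem θ)
  · exact Eventually.of_forall fun _ => hs.mul_left _
  · exact integrable_const _
  · refine Eventually.of_forall fun θ => ?_
    have := (hasSum_taylorCoeff hF (hball θ)).mul_left
      (circleMap 0 r θ * I * A (circleMap 0 r θ))
    rw [mul_assoc (circleMap 0 r θ * I)] at this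
    refine this.congr_fun fun k => ?_
    ring

/-- The square summable sequence attached to a boundary function `f` with finite `ρ(f)`. -/
theorem IsDiskWeight.exists_lp_of_rho_le {ω : ℝ → ℝ} (hω : IsDiskWeight ω) {f : ℝ → ℂ} {B : ℝ≥0∞}
    (hB : B < ⊤) (hf : rho ω f ≤ B) :
    ∃ d : lp (fun _ : ℕ => ℂ) 2, (∀ k, d k = -(Real.pi / monomialNorm ω k) *
      conj (fourierCoeffOn Real.two_pi_pos f (-((k : ℤ) + 1)))) ∧ ‖d‖ ≤ B.toReal := by
  set a : ℕ → ℂ := fun k => -(Real.pi / monomialNorm ω k) *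
      conj (fourierCoeffOn Real.two_pi_pos f (-((k : ℤ) + 1))) with ha
  have hnorm : ∀ k, ‖a k‖ ^ 2 = Real.pi *
      (‖fourierCoeffOn Real.two_pi_pos f (-((k : ℤ) + 1))‖ ^ 2 / moment ω k) := by
    intro k
    have h1 := hω.monomialNorm_pos k
    have h2 := hω.monomialNorm_sq k
    have h3 := hω.moment_pos k
    have h4 := Real.pi_pos
    rw [ha]
    simp only [norm_mul, norm_neg, norm_div, norm_real, RCLike.norm_conj,
      Real.norm_of_nonneg h1.le, Real.norm_of_nonneg h4.le]
    rw [mul_pow, div_pow, h2]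
    field_simp
  have hsum : ∀ s : Finset ℕ, ∑ k ∈ s, ‖a k‖ ^ 2 ≤ B.toReal ^ 2 := by
    intro s
    have h1 : ∑' k, ENNReal.ofReal (‖a k‖ ^ 2) ≤ B ^ 2 := by
      rw [rho, ← ENNReal.tsum_mul_left] at hf
      simp_rw [← ENNReal.ofReal_mul Real.pi_pos.le, ← hnorm] at hf
      have h2 := ENNReal.rpow_le_rpow hf (z := 2) (by norm_num)
      rw [← ENNReal.rpow_mul] at h2
      rwa [show (1 / 2 : ℝ) * 2 = 1 by norm_num, ENNReal.rpow_one, ENNReal.rpow_two] at h2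
    have h2 := (ENNReal.sum_le_tsum s).trans h1
    rw [← ENNReal.ofReal_sum_of_nonneg (fun _ _ => by positivity), ← ENNReal.ofReal_toReal hB.ne,
      ← ENNReal.ofReal_pow ENNReal.toReal_nonneg] at h2
    exact (ENNReal.ofReal_le_ofReal_iff (by positivity)).1 h2
  have hsum' : ∀ s : Finset ℕ, ∑ k ∈ s, ‖a k‖ ^ (2 : ℝ≥0∞).toReal ≤
      B.toReal ^ (2 : ℝ≥0∞).toReal := by
    simpa using hsum
  exact ⟨⟨a, memℓp_gen' hsum'⟩, fun k => rfl,
    lp.norm_le_of_forall_sum_le (by simp) ENNReal.toReal_nonneg hsum'⟩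

namespace IsConformalPair

variable {φ ψ γ : ℂ → ℂ} {G K : Set ℂ} {ω : ℝ → ℝ}

theorem exists_radius (h : IsConformalPair φ ψ G) (hK : IsCompact K) (hKG : K ⊆ G) :
    ∃ r₀, 0 ≤ r₀ ∧ r₀ < 1 ∧ K ⊆ φ '' ball 0 r₀ := by
  have hc : IsCompact (ψ '' K) := hK.image_of_continuousOn (h.continuousOn_symm.mono hKG)
  obtain ⟨r, hr, hsub⟩ := exists_lt_subset_ball hc.isClosed
    (image_subset_iff.2 fun z hz => h.mapsTo_symm (hKG hz))
  refine ⟨max r 0, le_max_right _ _, max_lt hr one_pos, fun z hz => ⟨ψ z, ?_, ?_⟩⟩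
  · exact ball_subset_ball (le_max_left _ _) (hsub (mem_image_of_mem ψ hz))
  · exact h.apply_symm (hKG hz)

/-- The exterior Cauchy formula in terms of Fourier and Taylor coefficients. -/
theorem hasSum_taylorCoeff_mul_fourierCoeffOn (h : IsConformalPair φ ψ G) (hK : IsCompact K)
    (hKG : K ⊆ G) (hγ : DifferentiableOn ℂ γ Kᶜ) (hγ0 : Tendsto γ (Bornology.cobounded ℂ) (𝓝 0))
    {ζ : ℂ} (hζ : ζ ∉ G) :
    HasSum (fun k => taylorCoeff (fun w => deriv φ w / (φ w - ζ)) k *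
      fourierCoeffOn Real.two_pi_pos (fun θ => γ (boundaryValue φ θ)) (-((k : ℤ) + 1)))
      (-γ ζ) := by
  obtain ⟨r₀, h0, h1, hKr⟩ := h.exists_radius hK hKG
  obtain ⟨r, hr₀, hr1⟩ := exists_between h1
  have hr : r ∈ Ioo r₀ 1 := ⟨hr₀, hr1⟩
  have hd : DifferentiableOn ℂ (fun w => deriv φ w / (φ w - ζ)) (ball 0 1) :=
    h.differentiableOn_deriv.div (h.differentiableOn.sub_const ζ) fun w hw h0 =>
      hζ (by rw [← sub_eq_zero.1 h0]; exact h.mapsTo hw)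
  have hA : ContinuousOn (fun w => γ (φ w)) (sphere 0 r) :=
    (h.differentiableOn_comp_annulus h1.le hKr hγ).continuousOn.mono (sphere_subset_annulus hr)
  have hs := (hasSum_taylorCoeff_mul_circleIntegral ⟨h0.trans_lt hr₀, hr1⟩ hA hd).mul_left
    (2 * Real.pi * I)⁻¹
  have hpi : (2 * Real.pi * I : ℂ) ≠ 0 := by simp [Real.pi_ne_zero]
  simp_rw [← mul_div_assoc] at hs
  rw [h.exterior_cauchy_formula h0 hKr hγ hγ0 hr hζ, ← mul_neg, inv_mul_cancel_left₀ hpi] at hs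
  refine hs.congr_fun fun k => ?_
  rw [h.fourierCoeffOn_comp_boundaryValue h0 hKr hK.isClosed hγ hr]
  ring

/-- The function `g` comes from a weak limit in `ℓ²` of the coefficient sequences of the boundary
functions of the approximants. -/
theorem exists_cauchyTransform_eq (h : IsConformalPair φ ψ G) (hω : IsDiskWeight ω)
    (hφ' : MemLp (deriv φ) 2 (diskMeasure ω)) (hγ : γ ∈ spaceWBar G ω φ) :
    ∃ g ∈ bergmanSpace G ω ψ, ∀ ζ ∈ (closure G)ᶜ, cauchyTransform G ω ψ g ζ = γ ζ := by
  obtain ⟨-, Gs, γs, hGs, hγs, hlim, -, hρ⟩ := hγ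
  have hKG : ∀ n, closure (Gs n) ⊆ G := fun n => (hGs.closure_subset n).trans (hGs.subset _)
  have hK : ∀ n, IsCompact (closure (Gs n)) := fun n =>
    (h.isBounded.subset (hGs.subset n)).isCompact_closure
  choose d hd hdn using fun n => hω.exists_lp_of_rho_le hρ
    (le_iSup (fun n => rho ω fun θ => γs n (boundaryValue φ θ)) n)
  obtain ⟨U, X, hU, hX⟩ := exists_ultrafilter_weak_limit hdn
  obtain ⟨f, hfd, hfm, hf⟩ := hω.exists_analytic_of_lp X
  set g : ℂ → ℂ := fun z => f (ψ z) * deriv ψ z with hg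
  have hgf : ∀ w ∈ ball (0 : ℂ) 1, g (φ w) * deriv φ w = f w := by
    intro w hw
    simp only [hg]
    rw [h.symm_apply hw, mul_assoc, h.deriv_symm_mul_deriv hw, mul_one]
  have hgd : DifferentiableOn ℂ g G :=
    (hfd.comp h.differentiableOn_symm h.mapsTo_symm).mul (h.differentiableOn_symm.deriv h.isOpen)
  refine ⟨g, (h.mem_bergmanSpace_iff hω hgd).2 (hfm.ae_eq ?_), fun ζ hζ => ?_⟩
  · filter_upwards [IsDiskWeight.ae_diskMeasure] with w hw using (hgf w hw).symm
  obtain ⟨hFd, hFm⟩ := h.kernel_properties hφ' hζ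
  obtain ⟨y, hy⟩ := hω.exists_lp_coeff hFd hFm
  have hpi : (Real.pi : ℂ) ≠ 0 := by exact_mod_cast Real.pi_ne_zero
  have hinner : ∀ n, inner ℂ (d n) y = Real.pi * γs n ζ := by
    intro n
    have h1 := (h.hasSum_taylorCoeff_mul_fourierCoeffOn (hK n) (hKG n) (hγs n).1 (hγs n).2
      (fun hz => hζ (subset_closure hz))).mul_left (-(Real.pi : ℂ))
    rw [neg_mul_neg] at h1
    refine (lp.hasSum_inner (𝕜 := ℂ) (d n) y).unique (h1.congr_fun fun k => ?_)
    have hm : (IsDiskWeight.monomialNorm ω k : ℂ) ≠ 0 := by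
      exact_mod_cast (hω.monomialNorm_pos k).ne'
    rw [hd, hy, RCLike.inner_apply]
    simp only [map_mul, map_neg, map_div₀, conj_ofReal, conj_conj]
    field_simp
  have hlimζ : Tendsto (fun n => γs n ζ) atTop (𝓝 (γ ζ)) :=
    (hlim {ζ} isCompact_singleton (singleton_subset_iff.2 hζ)).tendsto_at rfl
  have hXy : inner ℂ X y = Real.pi * γ ζ := by
    refine tendsto_nhds_unique (hX y) ?_
    simp_rw [hinner]
    exact (hlimζ.mono_left hU).const_mul _
  rw [h.cauchyTransform_eq hω, Measure.restrict_eq_self_of_ae_mem IsDiskWeight.ae_diskMeasure,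
    integral_congr_ae (g := fun w => deriv φ w / (φ w - ζ) * conj (f w)), hf _ hFd hFm y hy, hXy]
  · field_simp
  · filter_upwards [IsDiskWeight.ae_diskMeasure] with w hw
    rw [hgf w hw]
    ring

end IsConformalPair

end CauchyBergman

theorem mainTheorem1 (G : Set ℂ) (hGo : IsOpen G) (hGc : IsConnected G)
    (hGb : Bornology.IsBounded G)
    (hGJ : CauchyBergman.IsRectifiableJordanCurve (frontier G))
    (φ ψ : ℂ → ℂ) (hφ : CauchyBergman.IsConformalOfDisk φ G)
    (hψ : Set.InvOn ψ φ (Metric.ball 0 1) G)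
    (ω : ℝ → ℝ) (hωm : AEMeasurable ω (volume.restrict (Set.Ioc 0 1)))
    (hωpos : ∀ t ∈ Set.Ioc (0 : ℝ) 1, 0 < ω t)
    (hωint : IntegrableOn (fun z => ω (1 - ‖ψ z‖)) G volume)
    (hdense : CauchyBergman.PolynomialsDense G ω ψ) :
    (fun g => (closure G)ᶜ.domRestrict (CauchyBergman.cauchyTransform G ω ψ g)) ''
        CauchyBergman.bergmanSpace G ω ψ =
      (closure G)ᶜ.domRestrict '' CauchyBergman.spaceWBar G ω φ := by
  have h : CauchyBergman.IsConformalPair φ ψ G := ⟨hGo, hGb, hφ.1, hφ.2, hψ⟩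
  have hω : CauchyBergman.IsDiskWeight ω := h.isDiskWeight hωm hωpos hωint
  have hφ' := h.memLp_deriv hω hωint
  ext u
  constructor
  · rintro ⟨g, hg, rfl⟩
    exact ⟨_, h.cauchyTransform_mem_spaceWBar hω hφ' hg, rfl⟩
  · rintro ⟨γ, hγ, rfl⟩
    obtain ⟨g, hg, hgγ⟩ := h.exists_cauchyTransform_eq hω hφ' hγ
    exact ⟨g, hg, funext fun ζ => hgγ ζ ζ.2⟩
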